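/- **Setting.** Squares of the infinite chessboard are identified with points of $\mathbb{Z}^2$. An $(r,s)$-leaper moves from $(x,y)$ to $(x\pm r,y\pm s)$ and $(x\pm s,y\pm r)$; it is skew if $r,s\neq0$ and $r\ne s$. Let $A_1,\dots,A_8$ be the matrices $\left(\begin{smallmatrix}0&1\\1&0\end{smallmatrix}\right)$, $\left(\begin{smallmatrix}1&0\\0&1\end{smallmatrix}\right)$, $\left(\begin{smallmatrix}-1&0\\0&1\end{smallmatrix}\right)$, $\left(\begin{smallmatrix}0&-1\\1&0\end{smallmatrix}\right)$ and $A_{i+4}=-A_i$ for $i=1,\dots,4$. A move $v$ of a skew $(p,q)$-leaper, $p<q$, has direction $i$ if $v^T=A_i\left(\begin{smallmatrix}p\\q\end{smallmatrix}\right)$. A *direction graph* is a symmetric directed graph with arcs labeled by $1,\dots,8$ such that the sum of the matrices $A_i$ over the labels of every simple directed cycle is zero. Two direction graphs *coincide* if there is a bijection of their vertex sets preserving arcs and labels. A permutation $\pi$ of $\{1,\dots,8\}$ is an *equivalence permutation* if there are real $2\times2$ matrices $P,Q$ with $A_{\pi(i)}=PA_iQ$ for all $i$; two direction graphs are *equivalent*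 if relabeling the first by some equivalence permutation gives the second. A direction graph is *extracted from* a graph $G$ whose vertices are squares and whose edges are moves of a skew leaper if there is a bijection of vertex sets under which arcs labeled $i$ correspond to the moves of direction $i$ along edges of $G$. Consider cycles partitioned into eight paths $a^{E}a^{NE}a^{N}\cdots a^{SE}$, and write $-w$ for the reversal of a path $w$. For parameters $(p,q)$, the four lifts $b^Eb^{NE}\cdots b^{SE}$ are given by * $f$: $b^E=-a^{SW}{-a^W}{-a^{NW}}+(p+q,0)$, $b^{NE}=a^{NE}+(p,p)$, new parameters $(p,2p+q)$; * $g$: $b^E=a^E+(q-p,0)$, $b^{NE}=-a^S{-a^{SW}}{-a^W}+(q,q)$, new parameters $(q,2q-p)$; * $h$: $b^E=-a^S{-a^{SW}}{-a^W}{-a^{NW}}{-a^N}+(p+q,0)$, $b^{NE}=a^Ea^{NE}a^N+(q,q)$, new parameters $(q,p+2q)$; * $\hbar$: $b^E=a^{SE}a^Ea^{NE}+(p+q,0)$, $b^{NE}=-a^{SE}{-a^S}{-a^{SW}}{-a^W}{-a^{NW}}+(q,q)$, new parameters $(q,p+2q)$, the other six paths being defined symmetrically (by rotation through multiples of $90^\circ$).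 For a skew $(r,s)$-leaper $M$, $r<s$, the initial cycle of type $o\in\{f,g,h\}$ consists of eight one-square paths, obtained by rotation from the squares in the sections $E$, $NE$: these are $(r+s,0),(r,r)$ for $o=f$; $(s-r,0),(s,s)$ for $o=g$; $(r+s,0),(s,s)$ for $o=h$. Its parameters are $(r,2r+s)$, $(s,2s-r)$, $(s,r+2s)$, respectively. For a string $e=e_1\cdots e_l$ over $\{f,g,h,\hbar\}$, lifting the initial cycle of type $o$ successively by $e_l,\dots,e_1$ gives a cycle $D^M_o(e)$ of $M$, with final parameters $(p,q)$; let $C^M_o(e)$ be the graph on the squares of $D^M_o(e)$ whose edges are all pairs of these squares joined by a move of a $(p,q)$-leaper. A *fundamental direction cycle of descent $e$* is a direction graph extracted from $C^M_o(e)$ for some skew $M$ and some $o$; a *second fundamental direction cycle of origin $o$ and descent $e$* is a direction graph extracted from the cycle $D^M_o(e)$ for some skew $M$. The *companion* of a string is obtained by exchanging $f\leftrightarrow g$ and $h\leftrightarrow\hbar$. **Theorem.** 1. For all skew $M$, all $o\in\{f,g,h\}$ and all strings $e$ over $\{f,g,h,\hbar\}$, direction graphs can be extracted from $C^M_o(e)$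 and from $D^M_o(e)$. 2. Two fundamental direction cycles, of descents $e'$ and $e''$, coincide if and only if $e'=e''$. 3. Two fundamental direction cycles, of descents $e'$ and $e''$, are equivalent if and only if either $e'=e''$ or $e'$ and $e''$ are companions. 4. Let $\Phi$ be a fundamental direction cycle, or a second fundamental direction cycle of any origin, of descent $e$. Then $\Phi$ is not equivalent to any fundamental direction cycle, nor to any second fundamental direction cycle of origin $g$ or $h$, whose descent is a string over $\{f,g,h\}$, if and only if $e$ contains both $h$ and $\hbar$. -/

import Mathlib

namespace LeaperGraphs

/-! ## Skew directions, direction matrices, direction graphs -/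

/-- Squares of the infinite chessboard; a square is identified with the integer coordinates of
its center. -/
abbrev Square := ℤ × ℤ

/-- The eight skew directions, numbered counterclockwise from east-northeast. The element `k`
stands for the direction usually labeled `k + 1`. -/
abbrev SkewDir := Fin 8

/-- The direction matrices, `A₁, …, A₈` in this order. -/
def dirMatrix : SkewDir → Matrix (Fin 2) (Fin 2) ℤ :=
  ![!![0, 1; 1, 0], !![1, 0; 0, 1], !![-1, 0; 0, 1], !![0, -1; 1, 0],
    !![0, -1; -1, 0], !![-1, 0; 0, -1], !![1, 0; 0, -1], !![0, 1; -1, 0]]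

/-- A direction graph: a symmetric directed graph whose arcs are labeled with skew directions so
that the sum of the direction matrices over every simple (directed) cycle vanishes. `Arc x i y`
says that there is an arc from `x` to `y` and that its label is `i`. A simple cycle of length
`n + 1` is an injective cyclic sequence of vertices (addition in `Fin (n + 1)` is cyclic); the two
arcs of a symmetric pair form one of length two. -/
structure DirectionGraph where
  /-- vertices -/
  V : Type
  /-- labeled arcs -/
  Arc : V → SkewDir → V → Prop
  label_unique : ∀ x y i j, Arc x i y → Arc x j y → i = j
  symm : ∀ x y i, Arc x i y → ∃ j, Arc y j x
  cycle_sum : ∀ (n : ℕ) (x : Fin (n + 1) → V) (i : Fin (n + 1) → SkewDir),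
    Function.Injective x → (∀ k, Arc (x k) (i k) (x (k + 1))) → ∑ k, dirMatrix (i k) = 0

/-- Two direction graphs coincide if some bijection between their vertices preserves the arcs
and their labels. -/
def DirectionGraph.Coincide (Φ Ψ : DirectionGraph) : Prop :=
  ∃ σ : Φ.V ≃ Ψ.V, ∀ x i y, Φ.Arc x i y ↔ Ψ.Arc (σ x) i (σ y)

/-- `π` is an equivalence permutation: it is induced by two real matrices `P` and `Q`. -/
def IsEquivalencePerm (π : Equiv.Perm SkewDir) : Prop :=
  ∃ P Q : Matrix (Fin 2) (Fin 2) ℝ, ∀ i,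
    (dirMatrix (π i)).map (fun z : ℤ => (z : ℝ)) =
      P * (dirMatrix i).map (fun z : ℤ => (z : ℝ)) * Q

/-- Two direction graphs are equivalent if relabeling the arcs of the first one by some
equivalence permutation gives the second one. -/
def DirectionGraph.Equivalent (Φ Ψ : DirectionGraph) : Prop :=
  ∃ π : Equiv.Perm SkewDir, IsEquivalencePerm π ∧
    ∃ σ : Φ.V ≃ Ψ.V, ∀ x i y, Φ.Arc x i y ↔ Ψ.Arc (σ x) (π i) (σ y)

/-! ## Leaper graphs and extraction of direction graphs -/

/-- A move of a `(p, q)`-leaper leads from `a` to `b`. -/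
def IsLeaperMove (p q : ℤ) (a b : Square) : Prop :=
  (|b.1 - a.1| = p ∧ |b.2 - a.2| = q) ∨ (|b.1 - a.1| = q ∧ |b.2 - a.2| = p)

/-- The leaper graph of a `(p, q)`-leaper over the board `B`. -/
def leaperGraph (p q : ℤ) (B : Set Square) : SimpleGraph B :=
  SimpleGraph.fromRel fun a b => IsLeaperMove p q a b

/-- A move of direction `i` of a skew `(p, q)`-leaper, `p < q`, leads from `a` to `b`. -/
def IsMoveOfDir (p q : ℤ) (i : SkewDir) (a b : Square) : Prop :=
  ![b.1 - a.1, b.2 - a.2] = (dirMatrix i).mulVec ![p, q]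

/-- `Φ` is extracted from the graph `G`, the vertices of which are the squares of `B` and the
edges of which are moves of a skew `(p, q)`-leaper, `p < q`. -/
def DirectionGraph.ExtractedFrom (Φ : DirectionGraph) (p q : ℤ) {B : Set Square}
    (G : SimpleGraph B) : Prop :=
  ∃ σ : B ≃ Φ.V, ∀ a b i,
    (G.Adj a b ∧ IsMoveOfDir p q i (a : Square) (b : Square)) ↔ Φ.Arc (σ a) i (σ b)

/-! ## Lifting transformations -/

/-- The characters of descents; `hbar` stands for `ħ`. -/
inductive LiftType
  | f
  | g
  | h
  | hbar

/-- The types of initial cycles. -/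
inductive OriginType
  | f
  | g
  | h

/-- The compass directions E, NE, N, NW, W, SW, S, SE, in this order. -/
def compass : Fin 8 → Square :=
  ![(1, 0), (1, 1), (0, 1), (-1, 1), (-1, 0), (-1, -1), (0, -1), (1, -1)]

/-- A cycle partitioned into eight paths `a^E, a^NE, …, a^SE`. -/
abbrev OctoPath := Fin 8 → List Square

/-- Translation of a path. -/
def shift (w : List Square) (v : Square) : List Square := w.map (· + v)

/-- The lift of type `t` of a `(p, q)`-perfect cycle with perfect partitioning `a`, together with
its partitioning. The path `-w` is `w.reverse`; the index `i + k` is `k` steps counterclockwise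
from `i`; the even indices are E, N, W, S and the odd ones NE, NW, SW, SE. -/
def lift (t : LiftType) (p q : ℤ) (a : OctoPath) : OctoPath := fun i =>
  match t with
  | .f =>
    if i.val % 2 = 0 then
      shift ((a (i + 5)).reverse ++ (a (i + 4)).reverse ++ (a (i + 3)).reverse)
        ((p + q) • compass i)
    else shift (a i) (p • compass i)
  | .g =>
    if i.val % 2 = 0 then shift (a i) ((q - p) • compass i)
    else
      shift ((a (i + 5)).reverse ++ (a (i + 4)).reverse ++ (a (i + 3)).reverse) (q • compass i)
  | .h =>
    if i.val % 2 = 0 then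
      shift ((a (i + 6)).reverse ++ (a (i + 5)).reverse ++ (a (i + 4)).reverse ++
        (a (i + 3)).reverse ++ (a (i + 2)).reverse) ((p + q) • compass i)
    else shift (a (i - 1) ++ a i ++ a (i + 1)) (q • compass i)
  | .hbar =>
    if i.val % 2 = 0 then shift (a (i - 1) ++ a i ++ a (i + 1)) ((p + q) • compass i)
    else
      shift ((a (i + 6)).reverse ++ (a (i + 5)).reverse ++ (a (i + 4)).reverse ++
        (a (i + 3)).reverse ++ (a (i + 2)).reverse) (q • compass i)

/-- The parameters of the lift of type `t` of a `(p, q)`-perfect cycle. -/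
def liftParams (t : LiftType) (pq : ℤ × ℤ) : ℤ × ℤ :=
  match t with
  | .f => (pq.1, 2 * pq.1 + pq.2)
  | .g => (pq.2, 2 * pq.2 - pq.1)
  | .h => (pq.2, pq.1 + 2 * pq.2)
  | .hbar => (pq.2, pq.1 + 2 * pq.2)

/-- The initial cycle of type `o` of an `(r, s)`-leaper, partitioned into its eight squares. -/
def initialCycle (o : OriginType) (r s : ℤ) : OctoPath := fun i =>
  match o with
  | .f => if i.val % 2 = 0 then [(r + s) • compass i] else [r • compass i]
  | .g => if i.val % 2 = 0 then [(s - r) • compass i] else [s • compass i]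
  | .h => if i.val % 2 = 0 then [(r + s) • compass i] else [s • compass i]

/-- The parameters for which the initial cycle of type `o` is perfect. -/
def initialParams (o : OriginType) (r s : ℤ) : ℤ × ℤ :=
  match o with
  | .f => (r, 2 * r + s)
  | .g => (s, 2 * s - r)
  | .h => (s, r + 2 * s)

/-- The proportions `(p, q)` of the leaper `L^M_o(e)`, where `M` is an `(r, s)`-leaper. -/
def proportions (r s : ℤ) (o : OriginType) : List LiftType → ℤ × ℤ
  | [] => initialParams o r s
  | t :: e => liftParams t (proportions r s o e)

/-- The cycle `D^M_o(e)` with its partitioning: lifts of types `e_l, …, e_1` are applied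
successively to the initial cycle. -/
def secondCycle (r s : ℤ) (o : OriginType) : List LiftType → OctoPath
  | [] => initialCycle o r s
  | t :: e => lift t (proportions r s o e).1 (proportions r s o e).2 (secondCycle r s o e)

/-- The squares of a partitioned cycle in the order in which they are visited. -/
def OctoPath.squares (a : OctoPath) : List Square := (List.finRange 8).flatMap a

/-- The board formed by the squares of a partitioned cycle. -/
def OctoPath.board (a : OctoPath) : Set Square := {x | x ∈ OctoPath.squares a}

/-- A partitioned cycle as a graph: its vertices are its squares, and its edges join the squares
that are visited successively (cyclically). -/
def OctoPath.cycleGraph (a : OctoPath) : SimpleGraph (OctoPath.board a) :=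
  SimpleGraph.fromRel fun x y => ∃ k < (OctoPath.squares a).length,
    (OctoPath.squares a)[k]? = some (x : Square) ∧
      (OctoPath.squares a)[(k + 1) % (OctoPath.squares a).length]? = some (y : Square)

/-- The cycle `C^M_o(e)` : the leaper graph of the leaper `L^M_o(e)` over the board `B^M_o(e)`. -/
def firstCycle (r s : ℤ) (o : OriginType) (e : List LiftType) :
    SimpleGraph (OctoPath.board (secondCycle r s o e)) :=
  leaperGraph (proportions r s o e).1 (proportions r s o e).2
    (OctoPath.board (secondCycle r s o e))

/-! ## Fundamental direction cycles -/

/-- `Φ` is extracted from `C^M_o(e)`, where `M` is an `(r, s)`-leaper. -/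
def ExtractedFromFirst (r s : ℕ) (o : OriginType) (e : List LiftType) (Φ : DirectionGraph) :
    Prop :=
  Φ.ExtractedFrom (proportions r s o e).1 (proportions r s o e).2 (firstCycle r s o e)

/-- `Φ` is extracted from `D^M_o(e)`, where `M` is an `(r, s)`-leaper. -/
def ExtractedFromSecond (r s : ℕ) (o : OriginType) (e : List LiftType) (Φ : DirectionGraph) :
    Prop :=
  Φ.ExtractedFrom r s (OctoPath.cycleGraph (secondCycle r s o e))

/-- `Φ` is a fundamental direction cycle of descent `e`: it is extracted from `C^M_o(e)` for some
skew leaper `M` and some type `o`. -/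
def IsFundamental (e : List LiftType) (Φ : DirectionGraph) : Prop :=
  ∃ r s : ℕ, 0 < r ∧ r < s ∧ ∃ o, ExtractedFromFirst r s o e Φ

/-- `Φ` is a second fundamental direction cycle of origin `o` and descent `e`: it is extracted
from `D^M_o(e)` for some skew leaper `M`. -/
def IsSecondFundamental (o : OriginType) (e : List LiftType) (Φ : DirectionGraph) : Prop :=
  ∃ r s : ℕ, 0 < r ∧ r < s ∧ ExtractedFromSecond r s o e Φ

/-- The dual direction graphs of descent `e` of the large family: the fundamental direction cycle
and the second fundamental direction cycles of descent `e`. -/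
def IsFundamentalOrSecond (e : List LiftType) (Φ : DirectionGraph) : Prop :=
  IsFundamental e Φ ∨ ∃ o, IsSecondFundamental o e Φ

/-- The dual direction graphs of the original family: descents composed of `f`, `g`, `h` only,
origins `g` and `h` only. -/
def IsClassical (Ψ : DirectionGraph) : Prop :=
  ∃ e : List LiftType, LiftType.hbar ∉ e ∧
    (IsFundamental e Ψ ∨ IsSecondFundamental .g e Ψ ∨ IsSecondFundamental .h e Ψ)

/-- Exchange of `f` and `g`, and of `h` and `ħ`. -/
def LiftType.companion : LiftType → LiftType
  | .f => .g
  | .g => .f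
  | .h => .hbar
  | .hbar => .h

/-- The companion of a string. -/
def companion (e : List LiftType) : List LiftType := e.map LiftType.companion

end LeaperGraphs

/-!
The lifts make sense for squares with coordinates in any abelian group, so `D^M_o(e)` is the image
of a cycle with formal coordinates `a * p + b * q`, where `p`, `q` are the parameters of the
initial cycle. Inequalities and parities preserved by the lifts show that for `0 < p < q` this
evaluation is injective on the squares, and that the only moves of the `(p', q')`-leaper between
the squares, where `(p', q')` are the final parameters, have directions `i + 3` and `i + 4` out of
section `i`. Hence a fundamental direction cycle depends only on its descent. Rotation through
`45°` with scaling by `√2` carries the perfect cycle of parameters `(p, q)` and descent `e` to that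
of parameters `(q - p, q + p)` and companion descent, so companions give equivalent direction
cycles.

For the converse, an equivalence permutation maps pairs of directions whose matrices differ by a
common right factor to such pairs. The numbers of vertices whose two outgoing arcs have directions
paired in one of the four possible ways are therefore invariant up to order. For a fundamental
direction cycle the nonzero ones are the numbers of squares in the sections of both kinds, the
product of one `2 × 2` matrix for each lift with the vector `(1, 1)`; they determine the descent,
and their exchange is the passage to the companion. For a second fundamental direction cycle the
matrices are multiplied in the reverse order and transposed, which exchanges `f` with `g` and fixes
`h` and `ħ`. Finally, both passing to the companion and transposing preserve whether a string
contains both `h` and `ħ`.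
-/

namespace LeaperGraphs

section PerfectCycles

variable {A B : Type*} [AddCommGroup A] [AddCommGroup B] {X Y : Type*}

/-- The path `a^i` together with the paths adjacent to it. -/
def triple (a : Fin 8 → List X) (i : Fin 8) : List X := a (i - 1) ++ a i ++ a (i + 1)

/-- The path `a^i` together with the two nearest paths on each side. -/
def quintuple (a : Fin 8 → List X) (i : Fin 8) : List X :=
  a (i - 2) ++ a (i - 1) ++ a i ++ a (i + 1) ++ a (i + 2)

/-- The path `b^i` of a lift of type `t` before translation. The rules for the odd sections are the
rules of the companion type for the even ones. -/
def liftPieces (t : LiftType) (a : Fin 8 → List X) (i : Fin 8) : List X :=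
  match if i.val % 2 = 0 then t else t.companion with
  | .f => (triple a (i + 4)).reverse
  | .g => a i
  | .h => (quintuple a (i + 4)).reverse
  | .hbar => triple a i

/-- The multiple of `compass i` by which a lift of type `t` translates the path `b^i`. -/
def liftCoeff (t : LiftType) (p q : A) (i : Fin 8) : A :=
  match t with
  | .f => if i.val % 2 = 0 then p + q else p
  | .g => if i.val % 2 = 0 then q - p else q
  | .h | .hbar => if i.val % 2 = 0 then p + q else q

/-- The vector `a • compass i`, with `a` in an arbitrary abelian group. -/
def compassVec (i : Fin 8) (a : A) : A × A := ((compass i).1 • a, (compass i).2 • a)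

/-- `liftParams` with values in an arbitrary abelian group. -/
def nextParams (t : LiftType) (p q : A) : A × A :=
  match t with
  | .f => (p, p + p + q)
  | .g => (q, q + q - p)
  | .h | .hbar => (q, p + q + q)

/-- The parameters obtained from `(p, q)` by the lifts of descent `e`. -/
def params (p q : A) : List LiftType → A × A
  | [] => (p, q)
  | t :: e => nextParams t (params p q e).1 (params p q e).2

/-- The partitioned cycle of descent `e` over the initial cycle of parameters `(p, q)`. The
parameters live in an arbitrary abelian group, so that they may also be formal. -/
def perfectCycle (p q : A) : List LiftType → Fin 8 → List (A × A)
  | [], i => [compassVec i (if i.val % 2 = 0 then q - p else p)]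
  | t :: e, i => (liftPieces t (perfectCycle p q e) i).map
      (· + compassVec i (liftCoeff t (params p q e).1 (params p q e).2 i))

theorem liftPieces_map (t : LiftType) (a : Fin 8 → List X) (φ : X → Y) (i : Fin 8) :
    liftPieces t (fun j => (a j).map φ) i = (liftPieces t a i).map φ := by
  unfold liftPieces
  split <;> simp only [triple, quintuple, List.map_append, List.map_reverse]

theorem nextParams_map (φ : A →+ B) (t : LiftType) (p q : A) :
    nextParams t (φ p) (φ q) = Prod.map φ φ (nextParams t p q) := by
  cases t <;> simp [nextParams]

theorem params_map (φ : A →+ B) (p q : A) (e : List LiftType) :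
    params (φ p) (φ q) e = Prod.map φ φ (params p q e) := by
  induction e with
  | nil => rfl
  | cons t e ih => simp only [params, ih, Prod.map_fst, Prod.map_snd, nextParams_map]

theorem compassVec_map (φ : A →+ B) (i : Fin 8) (a : A) :
    compassVec i (φ a) = Prod.map φ φ (compassVec i a) := by
  simp [compassVec]

theorem liftCoeff_map (φ : A →+ B) (t : LiftType) (p q : A) (i : Fin 8) :
    liftCoeff t (φ p) (φ q) i = φ (liftCoeff t p q i) := by
  cases t <;> simp only [liftCoeff, apply_ite φ, map_add, map_sub]

theorem perfectCycle_map (φ : A →+ B) (p q : A) (e : List LiftType) (i : Fin 8) :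
    perfectCycle (φ p) (φ q) e i = (perfectCycle p q e i).map (Prod.map φ φ) := by
  induction e generalizing i with
  | nil =>
    simp only [perfectCycle, ← map_sub, ← apply_ite φ, compassVec_map, List.map_cons, List.map_nil]
  | cons t e ih =>
    simp only [perfectCycle, funext ih, liftPieces_map, params_map, Prod.map_fst, Prod.map_snd,
      liftCoeff_map, compassVec_map, List.map_map]
    congr! 1
    ext x <;> simp

/-- The first parameters of the initial cycle of type `o` of an `(r, s)`-leaper. -/
def startParams (o : OriginType) (r s : A) : A × A :=
  match o with
  | .f => (r, r + r + s)
  | .g => (s, s + s - r)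
  | .h => (s, r + s + s)

theorem proportions_eq_params (r s : ℤ) (o : OriginType) (e : List LiftType) :
    proportions r s o e = params (startParams o r s).1 (startParams o r s).2 e := by
  induction e with
  | nil => cases o <;> simp [proportions, params, startParams, initialParams] <;> ring
  | cons t e ih =>
    cases t <;> simp [proportions, params, ih, liftParams, nextParams] <;> ring

theorem lift_apply (t : LiftType) (p q : ℤ) (a : OctoPath) (i : Fin 8) :
    lift t p q a i = (liftPieces t a i).map (· + compassVec i (liftCoeff t p q i)) := by
  have hsmul (c : ℤ) : c • compass i = compassVec i c := by
    simp [compassVec, Prod.ext_iff, mul_comm]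
  have hadd (j k : Fin 8) : i + j + k = i + (j + k) := add_assoc i j k
  have hsub (j k : Fin 8) : i + j - k = i + (j - k) := add_sub_assoc i j k
  cases t <;> by_cases h : i.val % 2 = 0 <;>
    simp only [lift, liftPieces, LiftType.companion, triple, quintuple, liftCoeff, h, if_true,
      if_false, shift, hsmul, hadd, hsub, List.reverse_append, List.append_assoc] <;> rfl

theorem secondCycle_eq_perfectCycle (r s : ℤ) (o : OriginType) (e : List LiftType) :
    secondCycle r s o e = perfectCycle (startParams o r s).1 (startParams o r s).2 e := by
  induction e with
  | nil =>
    funext i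
    cases o <;> by_cases h : i.val % 2 = 0 <;>
      simp [secondCycle, perfectCycle, startParams, initialCycle, h, compassVec, Prod.ext_iff] <;>
      constructor <;> ring
  | cons t e ih =>
    funext i
    simp only [secondCycle, perfectCycle, ih, proportions_eq_params, lift_apply]

/-! ## The symmetries of a perfect cycle -/

/-- Rotation through `90°`. -/
def rot (x : A × A) : A × A := (-x.2, x.1)

/-- Rotation through `45°` followed by scaling by `√2`. -/
def halfRot (x : A × A) : A × A := (x.1 - x.2, x.1 + x.2)

theorem LiftType.companion_companion (t : LiftType) : t.companion.companion = t := by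
  cases t <;> rfl

theorem companion_companion (e : List LiftType) : companion (companion e) = e := by
  simp [companion, Function.comp_def, LiftType.companion_companion]

theorem val_add_one_mod_two (i : Fin 8) : (i + 1).val % 2 = 0 ↔ ¬ i.val % 2 = 0 := by
  revert i; decide

theorem liftPieces_companion_add_one (t : LiftType) (a : Fin 8 → List X) (i : Fin 8) :
    liftPieces t.companion a (i + 1) = liftPieces t (fun j => a (j + 1)) i := by
  have hfour (j : Fin 8) : j + 1 + 4 = j + 4 + 1 := add_right_comm j 1 4
  have htwo (j : Fin 8) : j + 1 + 2 = j + 2 + 1 := add_right_comm j 1 2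
  have hsub (j k : Fin 8) : j + 1 - k = j - k + 1 := add_sub_right_comm j 1 k
  have htype : (if (i + 1).val % 2 = 0 then t.companion else t.companion.companion) =
      if i.val % 2 = 0 then t else t.companion := by
    simp only [val_add_one_mod_two, LiftType.companion_companion, ite_not]
  simp only [liftPieces, htype, triple, quintuple, hfour, htwo, hsub]

theorem liftPieces_add_two (t : LiftType) (a : Fin 8 → List X) (i : Fin 8) :
    liftPieces t a (i + 2) = liftPieces t (fun j => a (j + 2)) i := by
  have htwo (j : Fin 8) : j + 2 = j + 1 + 1 := by rw [add_assoc]; rfl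
  have := liftPieces_companion_add_one t.companion a (i + 1)
  rw [LiftType.companion_companion, liftPieces_companion_add_one] at this
  simp only [htwo, this]

theorem params_companion (p q : A) (e : List LiftType) :
    params (q - p) (q + p) (companion e) =
      ((params p q e).2 - (params p q e).1, (params p q e).2 + (params p q e).1) := by
  induction e with
  | nil => rfl
  | cons t e ih =>
    rw [companion, List.map_cons, ← companion, params, params, ih]
    cases t <;> ext <;> simp only [LiftType.companion, nextParams] <;> abel

theorem compassVec_liftCoeff_companion (t : LiftType) (p q : A) (i : Fin 8) :
    compassVec (i + 1) (liftCoeff t.companion (q - p) (q + p) (i + 1)) =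
      halfRot (compassVec i (liftCoeff t p q i)) := by
  fin_cases i <;> cases t <;> ext <;>
    simp [compassVec, compass, liftCoeff, LiftType.companion, halfRot] <;> abel

theorem perfectCycle_companion_add_one (p q : A) (e : List LiftType) (i : Fin 8) :
    perfectCycle (q - p) (q + p) (companion e) (i + 1) = (perfectCycle p q e i).map halfRot := by
  induction e generalizing i with
  | nil =>
    fin_cases i <;> simp [perfectCycle, companion, compassVec, compass, halfRot]; abel
  | cons t e ih =>
    rw [companion, List.map_cons, ← companion, perfectCycle, perfectCycle, params_companion,
      compassVec_liftCoeff_companion, liftPieces_companion_add_one, funext ih, liftPieces_map,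
      List.map_map, List.map_map]
    congr! 1
    ext x <;> simp only [Function.comp_apply, halfRot, Prod.fst_add, Prod.snd_add] <;> abel

theorem perfectCycle_add_two (p q : A) (e : List LiftType) (i : Fin 8) :
    perfectCycle p q e (i + 2) = (perfectCycle p q e i).map rot := by
  have hpar (i : Fin 8) : (i + 2).val % 2 = i.val % 2 := by revert i; decide
  have hvec (i : Fin 8) (a : A) : compassVec (i + 2) a = rot (compassVec i a) := by
    fin_cases i <;> simp [compassVec, compass, rot]
  induction e generalizing i with
  | nil => simp only [perfectCycle, hpar, hvec, List.map_cons, List.map_nil]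
  | cons t e ih =>
    simp only [perfectCycle, liftPieces_add_two, liftCoeff, hpar, hvec, ih, liftPieces_map,
      List.map_map]
    congr! 1
    ext x <;> simp [rot, add_comm]

theorem mem_perfectCycle_add_two {p q : A} {e : List LiftType} {i : Fin 8} {x y : A} :
    (x, y) ∈ perfectCycle p q e (i + 2) ↔ (y, -x) ∈ perfectCycle p q e i := by
  rw [perfectCycle_add_two, List.mem_map]
  exact ⟨by rintro ⟨⟨u, v⟩, h, ⟨⟩⟩; simpa using h, fun h => ⟨_, h, by simp [rot]⟩⟩

theorem halfRot_injective [IsAddTorsionFree A] : Function.Injective (halfRot (A := A)) := by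
  rintro ⟨a, b⟩ ⟨c, d⟩ h
  obtain ⟨hsub, hadd⟩ := Prod.mk.inj h
  have hac : a = c := nsmul_right_injective two_ne_zero
    (by simpa [two_nsmul, add_add_sub_cancel] using congrArg₂ (· + ·) hadd hsub)
  subst hac
  simpa using hadd

theorem halfRot_mem_perfectCycle [IsAddTorsionFree A] {p q : A} {e : List LiftType} {i : Fin 8}
    {x : A × A} :
    halfRot x ∈ perfectCycle (q - p) (q + p) (companion e) (i + 1) ↔ x ∈ perfectCycle p q e i := by
  rw [perfectCycle_companion_add_one, List.mem_map_of_injective halfRot_injective]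

/-- Induction on the descent for statements about the sections of a perfect cycle: the symmetry
`halfRot` makes it enough to consider the section `E`. -/
theorem perfectCycle_induction {motive : A → A → List LiftType → Fin 8 → Prop}
    (nil : ∀ p q, motive p q [] 0)
    (cons : ∀ t e, (∀ p q i, motive p q e i) → ∀ p q, motive p q (t :: e) 0)
    (halfRot : ∀ p q e i, motive (q - p) (q + p) (companion e) (i + 1) → motive p q e i)
    (p q : A) (e : List LiftType) (i : Fin 8) : motive p q e i := by
  induction hn : e.length using Nat.strong_induction_on generalizing p q e i with
  | h n ih =>
    have section_zero : ∀ p q e, e.length = n → motive p q e 0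
      | p, q, [], _ => nil p q
      | p, q, t :: e, he => cons t e (fun p q i => ih e.length (by grind) p q e i rfl) p q
    induction i using Fin.reverseInduction generalizing p q e with
    | last => exact halfRot p q e _ (section_zero _ _ _ (by simpa [companion] using hn))
    | cast i ihi =>
      refine halfRot p q e _ ?_
      rw [Fin.coeSucc_eq_succ]
      exact ihi _ _ _ (by simpa [companion] using hn)

/-- The move of direction `i` of a `(p, q)`-leaper. -/
def moveVec (p q : A) (i : Fin 8) : A × A :=
  (dirMatrix i 0 0 • p + dirMatrix i 0 1 • q, dirMatrix i 1 0 • p + dirMatrix i 1 1 • q)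

/-- The move of direction `i` between the squares of a perfect cycle of descent `e`. -/
def stepVec (p q : A) (e : List LiftType) (i : Fin 8) : A × A :=
  moveVec (params p q e).1 (params p q e).2 i

theorem moveVec_map (φ : A →+ B) (p q : A) (i : Fin 8) :
    moveVec (φ p) (φ q) i = Prod.map φ φ (moveVec p q i) := by
  simp [moveVec]

theorem moveVec_add_four (p q : A) (i : Fin 8) : moveVec p q (i + 4) = -moveVec p q i := by
  fin_cases i <;> simp [moveVec, dirMatrix]

theorem halfRot_moveVec (p q : A) (i : Fin 8) :
    halfRot (moveVec p q i) = moveVec (q - p) (q + p) (i + 1) := by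
  fin_cases i <;> ext <;> simp [moveVec, dirMatrix, halfRot] <;> abel

theorem halfRot_stepVec (p q : A) (e : List LiftType) (i : Fin 8) :
    halfRot (stepVec p q e i) = stepVec (q - p) (q + p) (companion e) (i + 1) := by
  rw [stepVec, stepVec, params_companion, halfRot_moveVec]

theorem halfRot_add (x y : A × A) : halfRot (x + y) = halfRot x + halfRot y := by
  ext <;> simp only [halfRot, Prod.fst_add, Prod.snd_add] <;> abel

theorem mem_perfectCycle_cons {p q : A} {t : LiftType} {e : List LiftType} {i : Fin 8}
    {x : A × A} : x ∈ perfectCycle p q (t :: e) i ↔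
      x - compassVec i (liftCoeff t (params p q e).1 (params p q e).2 i) ∈
        liftPieces t (perfectCycle p q e) i := by
  simp [perfectCycle, ← eq_sub_iff_add_eq]

theorem add_stepVec_mem_perfectCycle [IsAddTorsionFree A] (p q : A) (e : List LiftType)
    (i : Fin 8) : ∀ x ∈ perfectCycle p q e i,
      (x + stepVec p q e (i + 3) ∈ perfectCycle p q e (i + 3) ∨
        x + stepVec p q e (i + 3) ∈ perfectCycle p q e (i + 4)) ∧
      (x + stepVec p q e (i + 4) ∈ perfectCycle p q e (i + 4) ∨
        x + stepVec p q e (i + 4) ∈ perfectCycle p q e (i + 5)) := by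
  induction p, q, e, i using perfectCycle_induction with
  | nil p q =>
    simp [perfectCycle, stepVec, moveVec, dirMatrix, compassVec, compass, params,
      sub_add_eq_add_sub]
  | cons t e ih p q =>
    have ih (i : Fin 8) (x : A × A) (hx : x ∈ perfectCycle p q e i) := ih p q i x hx
    rintro ⟨a, b⟩ h
    rw [mem_perfectCycle_cons] at h
    simp only [mem_perfectCycle_cons, stepVec, params] at ih ⊢
    generalize (params p q e).1 = P, (params p q e).2 = Q at h ih ⊢
    have neg_one : (-1 : Fin 8) = 7 := rfl
    have neg_two : (-2 : Fin 8) = 6 := rfl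
    cases t <;>
      simp only [liftPieces, triple, quintuple, moveVec, nextParams, compassVec, compass, dirMatrix,
        liftCoeff, LiftType.companion, neg_one, neg_two, Fin.reduceAdd, Fin.reduceSub,
        Fin.coe_ofNat_eq_mod, Nat.reduceMod, one_ne_zero, if_true, if_false, Matrix.cons_val,
        Matrix.of_apply, List.mem_append, List.mem_reverse, Prod.mk_add_mk, Prod.mk_sub_mk,
        zero_add, zero_sub, zero_smul] at h ⊢
    all_goals
      try casesm* _ ∨ _
      all_goals
        rename _ ∈ perfectCycle p q e _ => h
        have moves := ih _ _ h
        simp only [moveVec, dirMatrix, Fin.reduceAdd, Matrix.cons_val, Matrix.of_apply,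
          Prod.mk_add_mk, zero_smul] at moves
        clear ih
        abel_nf at moves h ⊢
        tauto
  | halfRot p q e i ih =>
    intro x hx
    have := ih (halfRot x) (halfRot_mem_perfectCycle.2 hx)
    simp only [add_right_comm i 1, ← halfRot_stepVec, ← halfRot_add, halfRot_mem_perfectCycle]
      at this
    exact this

/-! ## Separation of the sections of a perfect cycle -/

/-- The sections `E` and `NE` of a cycle of parameters `(p, q)` are separated: they lie in certain
regions, and certain differences between their squares do not occur. The excluded differences are
`0`, the moves other than those along the cycle, and the vectors which lifts turn into these. -/
structure Separated (p q : ℤ) (E N : ℤ → ℤ → Prop) : Prop where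
  pos : 0 < p ∧ p < q
  reflE {a b} : E a b → E a (-b)
  reflN {a b} : N a b → N b a
  regionE {a b} : E a b → 0 < a ∧ b < a ∧ -b < a ∧ a < q ∧ a + b < p + q ∧ a - b < p + q ∧
    b < q - p ∧ -b < q - p
  regionN {a b} : N a b → 0 < a ∧ 0 < b ∧ a < q ∧ b < q ∧ a - b < 2 * p ∧ b - a < 2 * p ∧
    a + b < p + q
  EN {a b c d} : E a b → N c d → ¬(c = a ∧ d = b) ∧ ¬(c = a - p ∧ d = b + q) ∧
    ¬(c = b - p ∧ d = q - a) ∧ ¬(c = b + q ∧ d = p - a)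
  NN {a b c d} : N a b → N c d → ¬(c = b - p ∧ d = q - a) ∧
    ¬(c = p + q - a ∧ d = q - p - b) ∧ ¬(c = a - 2 * p ∧ d = b)
  EE {a b c d} : E a b → E c d → ¬(c = b + q ∧ d = p - a) ∧
    ¬(c = p + q - a ∧ d = p - q - b) ∧ ¬(c = a + q - p ∧ d = b + q - p)

namespace Separated

variable {p q : ℤ} {E N E' N' : ℤ → ℤ → Prop}

theorem of_companion (S : Separated (q - p) (q + p) E' N')
    (hE : ∀ a b, E a b ↔ N' (a - b) (a + b)) (hN : ∀ a b, N a b ↔ E' (a + b) (b - a)) :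
    Separated p q E N := by
  have hpq := S.pos
  constructor
  · omega
  all_goals simp only [hE, hN]
  · intro a b h
    convert S.reflN h using 1 <;> ring
  · intro a b h
    convert S.reflE h using 1 <;> ring
  · intro a b h
    have := S.regionN h
    omega
  · intro a b h
    have := S.regionE h
    omega
  · intro a b c d h k
    have := S.EN (S.reflE k) (S.reflN h)
    omega
  · intro a b c d h k
    have hk := S.EE h k
    have kh := S.EE (S.reflE k) (S.reflE h)
    exact ⟨fun _ => kh.1 (by omega), fun _ => hk.2.1 (by omega), fun _ => kh.2.2 (by omega)⟩
  · intro a b c d h k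
    have hk := S.NN h k
    have kh := S.NN (S.reflN k) (S.reflN h)
    exact ⟨fun _ => kh.1 (by omega), fun _ => hk.2.1 (by omega), fun _ => kh.2.2 (by omega)⟩

theorem lift_f (S : Separated p q E N)
    (hE : ∀ a b, E' a b ↔ N (p + q - a) (-b) ∨ E (p + q - a) (-b) ∨ N b (p + q - a))
    (hN : ∀ a b, N' a b ↔ N (a - p) (b - p)) :
    Separated p (p + p + q) E' N' := by
  have hpq := S.pos
  constructor
  · omega
  all_goals simp only [hE, hN]
  · rintro a b (h | h | h)
    · exact .inr (.inr (S.reflN h))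
    · exact .inr (.inl (S.reflE h))
    · exact .inl (by simpa using S.reflN h)
  · exact S.reflN
  · rintro a b (h | h | h) <;> first | have := S.regionE h; omega | have := S.regionN h; omega
  · intro a b h
    have := S.regionN h
    omega
  · rintro a b c d (h | h | h) k <;> have := S.regionN k <;> first
      | have := S.regionN h; have := S.NN h k; have := S.NN (S.reflN h) (S.reflN k); omega
      | have := S.regionE h; have := S.EN (S.reflE h) (S.reflN k); omega
  · intro a b c d h k
    have := S.NN h k
    omega
  · rintro a b c d (h | h | h) (k | k | k) <;> first
      | have := S.regionN h; have := S.regionN k; have := S.NN h k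
        have := (S.NN (S.reflN h) (S.reflN k)).2.1; omega
      | have := S.regionE h; have := S.regionN k; have := S.EN h k; omega
      | have := S.regionN h; have := S.regionE k; omega
      | have := S.regionE h; have := S.regionE k; omega

theorem lift_h (S : Separated p q E N)
    (hE : ∀ a b, E' a b ↔ E (-b) (a - (p + q)) ∨ N (p + q - a) (-b) ∨ E (p + q - a) (-b) ∨
      N b (p + q - a) ∨ E b (p + q - a))
    (hN : ∀ a b, N' a b ↔ E (a - q) (b - q) ∨ N (a - q) (b - q) ∨ E (b - q) (q - a)) :
    Separated q (p + q + q) E' N' := by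
  have hpq := S.pos
  constructor
  · omega
  all_goals simp only [hE, hN]
  · rintro a b (h | h | h | h | h)
    · exact .inr (.inr (.inr (.inr (by simpa using S.reflE h))))
    · exact .inr (.inr (.inr (.inl (S.reflN h))))
    · exact .inr (.inr (.inl (S.reflE h)))
    · exact .inr (.inl (by simpa using S.reflN h))
    · exact .inl (by simpa using S.reflE h)
  · rintro a b (h | h | h)
    · exact .inr (.inr (by simpa using S.reflE h))
    · exact .inr (.inl (S.reflN h))
    · exact .inl (by simpa using S.reflE h)
  · rintro a b (h | h | h | h | h) <;> first
      | have := S.regionE h; omega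
      | have := S.regionN h; omega
  · rintro a b (h | h | h) <;> first | have := S.regionE h; omega | have := S.regionN h; omega
  · rintro a b c d (h | h | h | h | h) (k | k | k) <;> first
      | have := S.regionE h; have := S.regionE k; have := (S.EE k h).1
        have := (S.EE (S.reflE h) (S.reflE k)).2.1; omega
      | have := S.regionN h; have := S.regionE k; have := (S.EN k h).2.2.2; omega
      | have := S.regionN k; first | have := S.regionE h; omega | have := S.regionN h; omega
  · rintro a b c d (h | h | h) (k | k | k) <;> first
      | have := S.regionE h; have := S.regionE k; have := (S.EE (S.reflE k) (S.reflE h)).1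
        have := (S.EE h k).2.1; omega
      | have := S.regionN h; have := S.regionE k
        have := (S.EN (S.reflE k) (S.reflN h)).2.2.2; omega
      | have := S.regionN k; first | have := S.regionE h; omega | have := S.regionN h; omega
  · rintro a b c d (h | h | h | h | h) (k | k | k | k | k) <;> first
      | have := S.regionE h; have := S.regionE k; have := (S.EE (S.reflE k) (S.reflE h)).1
        have := (S.EE (S.reflE h) (S.reflE k)).2.1; omega
      | have := S.regionN h; have := S.regionE k
        have := (S.EN (S.reflE k) (S.reflN h)).2.2.2; omega
      | have := S.regionN k; first | have := S.regionE h; omega | have := S.regionN h; omega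

end Separated

/-- `(x, y)` lies on the section `E`. -/
def InE (p q : A) (e : List LiftType) (x y : A) : Prop := (x, y) ∈ perfectCycle p q e 0

/-- `(x, y)` lies on the section `NE`. -/
def InNE (p q : A) (e : List LiftType) (x y : A) : Prop := (x, y) ∈ perfectCycle p q e 1

theorem mem_perfectCycle_iff {p q : A} {e : List LiftType} {i : Fin 8} {x y : A} :
    (x, y) ∈ perfectCycle p q e i ↔
      ![InE p q e x y, InNE p q e x y, InE p q e y (-x), InNE p q e y (-x),
        InE p q e (-x) (-y), InNE p q e (-x) (-y), InE p q e (-y) x, InNE p q e (-y) x] i := by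
  have hrot (j : Fin 8) (x y : A) :
      (x, y) ∈ perfectCycle p q e (j + 2) ↔ (y, -x) ∈ perfectCycle p q e j :=
    mem_perfectCycle_add_two
  have h2 := hrot 0
  have h3 := hrot 1
  have h4 := hrot 2
  have h5 := hrot 3
  have h6 := hrot 4
  have h7 := hrot 5
  simp only [Fin.reduceAdd, zero_add] at h2 h3 h4 h5 h6 h7
  fin_cases i <;> simp [InE, InNE, *]

theorem inE_cons_f {p q : A} {e : List LiftType} {x y : A} :
    InE p q (.f :: e) x y ↔ InNE p q e ((params p q e).1 + (params p q e).2 - x) (-y) ∨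
      InE p q e ((params p q e).1 + (params p q e).2 - x) (-y) ∨
      InNE p q e y ((params p q e).1 + (params p q e).2 - x) := by
  rw [InE, mem_perfectCycle_cons]
  simp [liftPieces, triple, mem_perfectCycle_iff, liftCoeff, compassVec, compass]

theorem inNE_cons_f {p q : A} {e : List LiftType} {x y : A} :
    InNE p q (.f :: e) x y ↔ InNE p q e (x - (params p q e).1) (y - (params p q e).1) := by
  rw [InNE, mem_perfectCycle_cons]
  simp [liftPieces, LiftType.companion, InNE, liftCoeff, compassVec, compass]

theorem inE_cons_h {p q : A} {e : List LiftType} {x y : A} :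
    InE p q (.h :: e) x y ↔ InE p q e (-y) (x - ((params p q e).1 + (params p q e).2)) ∨
      InNE p q e ((params p q e).1 + (params p q e).2 - x) (-y) ∨
      InE p q e ((params p q e).1 + (params p q e).2 - x) (-y) ∨
      InNE p q e y ((params p q e).1 + (params p q e).2 - x) ∨
      InE p q e y ((params p q e).1 + (params p q e).2 - x) := by
  rw [InE, mem_perfectCycle_cons]
  simp [liftPieces, quintuple, mem_perfectCycle_iff, liftCoeff, compassVec, compass]

theorem inNE_cons_h {p q : A} {e : List LiftType} {x y : A} :
    InNE p q (.h :: e) x y ↔ InE p q e (x - (params p q e).2) (y - (params p q e).2) ∨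
      InNE p q e (x - (params p q e).2) (y - (params p q e).2) ∨
      InE p q e (y - (params p q e).2) ((params p q e).2 - x) := by
  rw [InNE, mem_perfectCycle_cons]
  simp [liftPieces, LiftType.companion, triple, mem_perfectCycle_iff, liftCoeff, compassVec,
    compass]

theorem Separated.of_companion_descent {p q : ℤ} {e : List LiftType}
    (S : Separated (params (q - p) (q + p) (companion e)).1
      (params (q - p) (q + p) (companion e)).2
      (InE (q - p) (q + p) (companion e)) (InNE (q - p) (q + p) (companion e))) :
    Separated (params p q e).1 (params p q e).2 (InE p q e) (InNE p q e) := by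
  rw [params_companion] at S
  refine S.of_companion (fun a b => halfRot_mem_perfectCycle.symm) fun a b => ?_
  rw [InNE, ← halfRot_mem_perfectCycle, halfRot, mem_perfectCycle_iff]
  simp

theorem separated_perfectCycle {p q : ℤ} (hp : 0 < p) (hpq : p < q) (e : List LiftType) :
    Separated (params p q e).1 (params p q e).2 (InE p q e) (InNE p q e) := by
  induction e generalizing p q with
  | nil =>
    constructor <;> simp [params, InE, InNE, perfectCycle, compassVec, compass] <;> grind
  | cons t e ih =>
    have ih_companion {p q : ℤ} (hp : 0 < p) (hpq : p < q) : Separated (params p q (companion e)).1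
        (params p q (companion e)).2 (InE p q (companion e)) (InNE p q (companion e)) := by
      apply Separated.of_companion_descent
      rw [companion_companion]
      exact ih (by omega) (by omega)
    cases t with
    | f => exact (ih hp hpq).lift_f (fun _ _ => inE_cons_f) fun _ _ => inNE_cons_f
    | h => exact (ih hp hpq).lift_h (fun _ _ => inE_cons_h) fun _ _ => inNE_cons_h
    | g =>
      refine .of_companion_descent ?_
      exact (ih_companion (by omega) (by omega)).lift_f (fun _ _ => inE_cons_f)
        fun _ _ => inNE_cons_f
    | hbar =>
      refine .of_companion_descent ?_
      exact (ih_companion (by omega) (by omega)).lift_h (fun _ _ => inE_cons_h)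
        fun _ _ => inNE_cons_h

theorem eq_zero_of_mem_of_mem {p q : ℤ} (hp : 0 < p) (hpq : p < q) {e : List LiftType}
    {x : Square} {j : Fin 8} (h : x ∈ perfectCycle p q e 0) (k : x ∈ perfectCycle p q e j) :
    j = 0 := by
  obtain ⟨a, b⟩ := x
  have S := separated_perfectCycle hp hpq e
  change InE p q e a b at h
  rw [mem_perfectCycle_iff] at k
  have := S.regionE h
  by_contra hj
  fin_cases j <;> simp only [Fin.reduceFinMk, Matrix.cons_val, not_true] at k hj <;> first
    | have := S.EN h k; omega
    | have := S.EN (S.reflE h) (S.reflN k); omega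
    | have := S.regionE k; omega
    | have := S.regionN k; omega

theorem section_unique {p q : ℤ} (hp : 0 < p) (hpq : p < q) {e : List LiftType} {i j : Fin 8}
    {x : Square} (hi : x ∈ perfectCycle p q e i) (hj : x ∈ perfectCycle p q e j) : i = j := by
  induction p, q, e, i using perfectCycle_induction generalizing x j with
  | nil | cons => exact (eq_zero_of_mem_of_mem hp hpq hi hj).symm
  | halfRot p q e i ih =>
    exact add_right_cancel (ih (by omega) (by omega) (halfRot_mem_perfectCycle.2 hi)
      (halfRot_mem_perfectCycle.2 hj))

theorem move_from_section_zero {p q : ℤ} (hp : 0 < p) (hpq : p < q) {e : List LiftType}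
    {x : Square} {j k : Fin 8} (h : x ∈ perfectCycle p q e 0)
    (hk : x + stepVec p q e k ∈ perfectCycle p q e j) :
    k = 3 ∨ k = 4 := by
  obtain ⟨a, b⟩ := x
  have S := separated_perfectCycle hp hpq e
  change InE p q e a b at h
  rw [stepVec, moveVec, Prod.mk_add_mk, mem_perfectCycle_iff] at hk
  generalize (params p q e).1 = P, (params p q e).2 = Q, InE p q e = E, InNE p q e = N at *
  have hPQ := S.pos
  have hE := S.regionE h
  by_contra! hne
  fin_cases k <;>
    simp only [Fin.reduceFinMk, Fin.reduceEq, ne_eq, not_true, false_and, and_false] at hne <;>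
    fin_cases j <;>
    simp only [dirMatrix, Fin.reduceFinMk, Matrix.cons_val, Matrix.of_apply, zero_smul, one_smul,
      neg_smul, zero_add, add_zero] at hk <;>
    first
    | have hE' := S.regionE hk; omega
    | have hN' := S.regionN hk; omega
    | have hEE := (S.EE h hk).1; omega
    | have hEE := (S.EE (S.reflE h) (S.reflE hk)).1; omega
    | have hEN := S.EN h hk; omega
    | have hEN := S.EN (S.reflE h) (S.reflN hk); omega

theorem eq_or_eq_of_add_stepVec_mem {p q : ℤ} (hp : 0 < p) (hpq : p < q) {e : List LiftType}
    {i j k : Fin 8} {x : Square} (hx : x ∈ perfectCycle p q e i)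
    (hk : x + stepVec p q e k ∈ perfectCycle p q e j) :
    k = i + 3 ∨ k = i + 4 := by
  induction p, q, e, i using perfectCycle_induction generalizing x j k with
  | nil | cons => exact move_from_section_zero hp hpq hx hk
  | halfRot p q e i ih =>
    have := ih (j := j + 1) (k := k + 1) (by omega) (by omega) (halfRot_mem_perfectCycle.2 hx)
      (by rwa [← halfRot_stepVec, ← halfRot_add, halfRot_mem_perfectCycle])
    simpa only [add_right_comm i 1, add_left_inj] using this

theorem perfectCycle_nodup {p q : ℤ} (hp : 0 < p) (hpq : p < q) (e : List LiftType) (i : Fin 8) :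
    (perfectCycle p q e i).Nodup := by
  have disjoint {p q : ℤ} (hp : 0 < p) (hpq : p < q) (e : List LiftType) (j k : Fin 8)
      (hjk : j ≠ k) : (perfectCycle p q e j).Disjoint (perfectCycle p q e k) :=
    List.disjoint_left.2 fun _ hj hk => hjk (section_unique hp hpq hj hk)
  induction p, q, e, i using perfectCycle_induction with
  | nil => simp [perfectCycle]
  | cons t e ih p q =>
    have ih (i : Fin 8) := ih p q i hp hpq
    have disjoint := disjoint hp hpq e
    have neg_one : (-1 : Fin 8) = 7 := rfl
    refine List.Nodup.map (add_left_injective _) ?_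
    cases t <;> simp [liftPieces, triple, quintuple, List.nodup_append', neg_one, ih, disjoint]
  | halfRot p q e i ih =>
    refine List.Nodup.of_map halfRot ?_
    rw [← perfectCycle_companion_add_one]
    exact ih (by omega) (by omega)

theorem squares_nodup {p q : ℤ} (hp : 0 < p) (hpq : p < q) (e : List LiftType) :
    (OctoPath.squares (perfectCycle p q e)).Nodup := by
  rw [OctoPath.squares, List.nodup_flatMap]
  refine ⟨fun i _ => perfectCycle_nodup hp hpq e i, ?_⟩
  exact (List.nodup_finRange 8).imp fun hij _ hi hj => hij (section_unique hp hpq hi hj)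

theorem sum_dirMatrix_eq_zero {p q : A} (h : LinearIndependent ℤ ![p, q]) {ι : Type*} [Fintype ι]
    (i : ι → Fin 8) (hs : ∑ k, moveVec p q (i k) = 0) : ∑ k, dirMatrix (i k) = 0 := by
  have h1 := congrArg Prod.fst hs
  have h2 := congrArg Prod.snd hs
  simp only [moveVec, Prod.fst_sum, Prod.snd_sum, Finset.sum_add_distrib, ← Finset.sum_smul,
    Prod.fst_zero, Prod.snd_zero] at h1 h2
  obtain ⟨h00, h01⟩ := LinearIndependent.pair_iff.1 h _ _ h1
  obtain ⟨h10, h11⟩ := LinearIndependent.pair_iff.1 h _ _ h2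
  ext a b
  simp only [Matrix.sum_apply, Matrix.zero_apply]
  fin_cases a <;> fin_cases b <;> assumption

theorem dirMatrix_injective : Function.Injective dirMatrix := by
  unfold Function.Injective
  decide

theorem moveVec_injective {p q : A} (h : LinearIndependent ℤ ![p, q]) :
    Function.Injective (moveVec p q) := by
  intro i j hij
  obtain ⟨h1, h2⟩ := Prod.mk.inj hij
  obtain ⟨h00, h01⟩ := h.eq_of_pair h1
  obtain ⟨h10, h11⟩ := h.eq_of_pair h2
  apply dirMatrix_injective
  ext a b
  fin_cases a <;> fin_cases b <;> assumption

theorem linearIndependent_params {p q : A} (h : LinearIndependent ℤ ![p, q])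
    (e : List LiftType) : LinearIndependent ℤ ![(params p q e).1, (params p q e).2] := by
  induction e with
  | nil => exact h
  | cons t e ih =>
    rw [LinearIndependent.pair_iff] at ih ⊢
    intro a b hab
    rw [params] at hab
    generalize (params p q e).1 = P, (params p q e).2 = Q at ih hab
    cases t
    case f =>
      have := ih (a + b + b) b (by rw [← hab, nextParams]; module)
      omega
    case g =>
      have := ih (-b) (a + b + b) (by rw [← hab, nextParams]; module)
      omega
    all_goals
      have := ih b (a + b + b) (by rw [← hab, nextParams]; module)
      omega

/-- The direction graph formed by vertices with coordinates `φ` in an abelian group and by arcs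
which are moves of linearly independent parameters. -/
def DirectionGraph.ofCoordinates {p q : A} (h : LinearIndependent ℤ ![p, q]) (V : Type)
    (φ : V → A × A) (Arc : V → SkewDir → V → Prop)
    (hφ : ∀ x i y, Arc x i y → φ y = φ x + moveVec p q i)
    (symm : ∀ x y i, Arc x i y → ∃ j, Arc y j x) : DirectionGraph where
  V := V
  Arc := Arc
  label_unique x y i j hi hj :=
    moveVec_injective h (add_left_cancel ((hφ _ _ _ hi).symm.trans (hφ _ _ _ hj)))
  symm := symm
  cycle_sum n x i _ hx := by
    refine sum_dirMatrix_eq_zero h i ?_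
    simp only [fun k => eq_sub_of_add_eq' (hφ _ _ _ (hx k)).symm, Finset.sum_sub_distrib]
    exact sub_eq_zero.2 (Equiv.sum_comp (Equiv.addRight 1) fun k => φ (x k))

/-! ## Fundamental direction cycles -/

/-- The squares of the perfect cycle of descent `e`. -/
def squareSet (p q : A) (e : List LiftType) : Set (A × A) := {x | ∃ i, x ∈ perfectCycle p q e i}

/-- The vertices of `Φ` correspond to the squares of the perfect cycle of descent `e`, and its arcs
correspond to the moves between these squares. -/
def IsMoveGraph (p q : A) (e : List LiftType) (Φ : DirectionGraph) : Prop :=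
  ∃ σ : squareSet p q e ≃ Φ.V, ∀ (a b : squareSet p q e) i,
    (b : A × A) = a + stepVec p q e i ↔ Φ.Arc (σ a) i (σ b)

theorem IsMoveGraph.coincide {p q : A} {e : List LiftType} {Φ Ψ : DirectionGraph}
    (hΦ : IsMoveGraph p q e Φ) (hΨ : IsMoveGraph p q e Ψ) : Φ.Coincide Ψ := by
  obtain ⟨σ, hσ⟩ := hΦ
  obtain ⟨τ, hτ⟩ := hΨ
  refine ⟨σ.symm.trans τ, fun x i y => ?_⟩
  simp only [Equiv.trans_apply, ← hτ, hσ, Equiv.apply_symm_apply]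

/-- The direction graph of descent `e` whose squares have formal coordinates: `(a, b)` stands for
`a * p + b * q`. -/
abbrev IsFormalMoveGraph (e : List LiftType) (Φ : DirectionGraph) : Prop :=
  IsMoveGraph ((1, 0) : ℤ × ℤ) (0, 1) e Φ

theorem linearIndependent_formal : LinearIndependent ℤ ![((1, 0) : ℤ × ℤ), (0, 1)] := by
  simp [LinearIndependent.pair_iff]

theorem exists_isFormalMoveGraph (e : List LiftType) : ∃ Φ, IsFormalMoveGraph e Φ := by
  refine ⟨.ofCoordinates (linearIndependent_params linearIndependent_formal e)
    (squareSet (1, 0) (0, 1) e) Subtype.val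
    (fun x i y => y.1 = x.1 + stepVec (1, 0) (0, 1) e i) (fun _ _ _ h => h)
    fun x y i h => ⟨i + 4, ?_⟩, Equiv.refl _, fun a b i => Iff.rfl⟩
  rw [h, stepVec, stepVec, moveVec_add_four, add_neg_cancel_right]

/-- Evaluation of formal coordinates. -/
def evalHom (p q : A) : ℤ × ℤ →+ A := (zmultiplesHom A p).coprod (zmultiplesHom A q)

/-- Evaluation of formal squares. -/
def evalSquare (p q : A) : (ℤ × ℤ) × (ℤ × ℤ) →+ A × A := (evalHom p q).prodMap (evalHom p q)

theorem perfectCycle_eval (p q : A) (e : List LiftType) (i : Fin 8) :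
    perfectCycle p q e i = (perfectCycle (1, 0) (0, 1) e i).map (evalSquare p q) := by
  have := perfectCycle_map (evalHom p q) (1, 0) (0, 1) e i
  simp only [evalHom, AddMonoidHom.coprod_apply, zmultiplesHom_apply, one_smul, zero_smul,
    add_zero, zero_add] at this
  exact this

theorem stepVec_eval (p q : A) (e : List LiftType) (i : Fin 8) :
    stepVec p q e i = evalSquare p q (stepVec (1, 0) (0, 1) e i) := by
  have hparams := params_map (evalHom p q) (1, 0) (0, 1) e
  have hmove := moveVec_map (evalHom p q) (params (1, 0) (0, 1) e).1 (params (1, 0) (0, 1) e).2 i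
  simp only [evalHom, AddMonoidHom.coprod_apply, zmultiplesHom_apply, one_smul, zero_smul,
    add_zero, zero_add] at hparams
  rw [stepVec, hparams]
  exact hmove

theorem evalSquare_bijOn {p q : ℤ} (hp : 0 < p) (hpq : p < q) (e : List LiftType) :
    Set.BijOn (evalSquare p q) (squareSet (1, 0) (0, 1) e) (squareSet p q e) := by
  have hsquares : OctoPath.squares (perfectCycle p q e) =
      ((List.finRange 8).flatMap (perfectCycle (1, 0) (0, 1) e)).map (evalSquare p q) := by
    rw [OctoPath.squares, List.map_flatMap, funext (perfectCycle_eval p q e)]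
  have hnodup := squares_nodup hp hpq e
  rw [hsquares] at hnodup
  refine ⟨?_, ?_, ?_⟩
  · rintro x ⟨i, hx⟩
    exact ⟨i, perfectCycle_eval p q e i ▸ List.mem_map_of_mem hx⟩
  · rintro x ⟨i, hx⟩ y ⟨j, hy⟩ hxy
    exact List.inj_on_of_nodup_map hnodup (List.mem_flatMap.2 ⟨i, List.mem_finRange i, hx⟩)
      (List.mem_flatMap.2 ⟨j, List.mem_finRange j, hy⟩) hxy
  · rintro x ⟨i, hx⟩
    rw [perfectCycle_eval, List.mem_map] at hx
    obtain ⟨y, hy, rfl⟩ := hx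
    exact ⟨y, ⟨i, hy⟩, rfl⟩

theorem add_stepVec_mem_squareSet [IsAddTorsionFree A] {p q : A} {e : List LiftType} {i k : Fin 8}
    {x : A × A} (hx : x ∈ perfectCycle p q e i) (hk : k = i + 3 ∨ k = i + 4) :
    x + stepVec p q e k ∈ squareSet p q e := by
  obtain ⟨h3, h4⟩ := add_stepVec_mem_perfectCycle p q e i x hx
  rcases hk with rfl | rfl
  · exact h3.elim (⟨_, ·⟩) (⟨_, ·⟩)
  · exact h4.elim (⟨_, ·⟩) (⟨_, ·⟩)

theorem eq_add_stepVec_iff_eval {p q : ℤ} (hp : 0 < p) (hpq : p < q) {e : List LiftType}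
    {a b : (ℤ × ℤ) × (ℤ × ℤ)} (ha : a ∈ squareSet (1, 0) (0, 1) e)
    (hb : b ∈ squareSet (1, 0) (0, 1) e) (k : Fin 8) :
    b = a + stepVec (1, 0) (0, 1) e k ↔
      evalSquare p q b = evalSquare p q a + stepVec p q e k := by
  have hbij := evalSquare_bijOn hp hpq e
  refine ⟨by rintro rfl; rw [map_add, ← stepVec_eval], fun hab => ?_⟩
  obtain ⟨i, hi⟩ := ha
  obtain ⟨j, hj⟩ := hbij.mapsTo hb
  have hk : k = i + 3 ∨ k = i + 4 := by
    refine eq_or_eq_of_add_stepVec_mem hp hpq (x := evalSquare p q a) (j := j) ?_ (hab ▸ hj)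
    exact perfectCycle_eval p q e i ▸ List.mem_map_of_mem hi
  refine hbij.injOn hb (add_stepVec_mem_squareSet hi hk) ?_
  rw [hab, map_add, ← stepVec_eval]

theorem isMoveGraph_iff_formal {p q : ℤ} (hp : 0 < p) (hpq : p < q) {e : List LiftType}
    {Φ : DirectionGraph} : IsMoveGraph p q e Φ ↔ IsFormalMoveGraph e Φ := by
  let τ := (evalSquare_bijOn hp hpq e).equiv
  have hτ (a b : squareSet (1, 0) (0, 1) e) (k : Fin 8) :
      b.1 = a.1 + stepVec (1, 0) (0, 1) e k ↔ (τ b : ℤ × ℤ) = τ a + stepVec p q e k :=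
    eq_add_stepVec_iff_eval hp hpq a.2 b.2 k
  constructor
  · rintro ⟨σ, h⟩
    exact ⟨τ.trans σ, fun a b k => (hτ a b k).trans (h _ _ _)⟩
  · rintro ⟨σ, h⟩
    refine ⟨τ.symm.trans σ, fun a b k => ?_⟩
    simp only [Equiv.trans_apply, ← h, hτ, Equiv.apply_symm_apply]

theorem isMoveOfDir_iff {p q : ℤ} {i : Fin 8} {a b : Square} :
    IsMoveOfDir p q i a b ↔ b = a + moveVec p q i := by
  rw [IsMoveOfDir, moveVec, Prod.ext_iff, ← List.ofFn_inj]
  simp [Matrix.mulVec, dotProduct, Fin.sum_univ_two, sub_eq_iff_eq_add']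

theorem board_secondCycle (r s : ℤ) (o : OriginType) (e : List LiftType) :
    OctoPath.board (secondCycle r s o e) =
      squareSet (startParams o r s).1 (startParams o r s).2 e := by
  ext x
  simp [OctoPath.board, OctoPath.squares, squareSet, secondCycle_eq_perfectCycle]

theorem startParams_pos {r s : ℤ} (hr : 0 < r) (hrs : r < s) (o : OriginType) :
    0 < (startParams o r s).1 ∧ (startParams o r s).1 < (startParams o r s).2 := by
  cases o <;> simp only [startParams] <;> omega

theorem isLeaperMove_moveVec {p q : ℤ} (hp : 0 < p) (hpq : p < q) (a : Square) (i : Fin 8) :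
    IsLeaperMove p q a (a + moveVec p q i) := by
  fin_cases i <;>
    simp [IsLeaperMove, moveVec, dirMatrix, abs_of_pos hp, abs_of_pos (hp.trans hpq)]

theorem moveVec_ne_zero {p q : ℤ} (hp : 0 < p) (i : Fin 8) : moveVec p q i ≠ 0 := by
  fin_cases i <;> simp [moveVec, dirMatrix, hp.ne']

theorem extractedFromFirst_iff {r s : ℕ} (hr : 0 < r) (hrs : r < s) {o : OriginType}
    {e : List LiftType} {Φ : DirectionGraph} :
    ExtractedFromFirst r s o e Φ ↔ IsFormalMoveGraph e Φ := by
  have hpos := startParams_pos (r := r) (s := s) (by omega) (by omega) o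
  have hparams := (separated_perfectCycle hpos.1 hpos.2 e).pos
  rw [← isMoveGraph_iff_formal hpos.1 hpos.2, ExtractedFromFirst, DirectionGraph.ExtractedFrom,
    IsMoveGraph, ← board_secondCycle]
  refine exists_congr fun σ => forall₃_congr fun a b i => iff_congr ?_ Iff.rfl
  rw [isMoveOfDir_iff, firstCycle, leaperGraph, SimpleGraph.fromRel_adj, proportions_eq_params]
  refine ⟨And.right, fun h => ⟨⟨?_, Or.inl ?_⟩, h⟩⟩
  · rintro rfl
    exact moveVec_ne_zero hparams.1 i (left_eq_add.1 h)
  · rw [h]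
    exact isLeaperMove_moveVec hparams.1 hparams.2 _ _

theorem isFundamental_iff {e : List LiftType} {Φ : DirectionGraph} :
    IsFundamental e Φ ↔ IsFormalMoveGraph e Φ := by
  refine ⟨?_, fun h => ⟨1, 2, by norm_num, by norm_num, .f, ?_⟩⟩
  · rintro ⟨r, s, hr, hrs, o, h⟩
    exact (extractedFromFirst_iff hr hrs).1 h
  · exact (extractedFromFirst_iff (by norm_num) (by norm_num)).2 h

theorem exists_extractedFromFirst {r s : ℕ} (hr : 0 < r) (hrs : r < s) (o : OriginType)
    (e : List LiftType) : ∃ Φ, ExtractedFromFirst r s o e Φ := by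
  simpa only [extractedFromFirst_iff hr hrs] using exists_isFormalMoveGraph e

/-! ## Equivalence permutations -/

theorem isEquivalencePerm_addRight_one : IsEquivalencePerm (Equiv.addRight 1) := by
  refine ⟨!![1, -1; 1, 1], !![-1 / 2, 1 / 2; 1 / 2, 1 / 2], fun i => ?_⟩
  fin_cases i <;> ext a b <;> fin_cases a <;> fin_cases b <;>
    simp only [Matrix.mul_apply, Fin.sum_univ_two, Matrix.map_apply] <;>
    simp [dirMatrix] <;> norm_num

theorem halfRot_bijOn [IsAddTorsionFree A] (p q : A) (e : List LiftType) :
    Set.BijOn halfRot (squareSet p q e) (squareSet (q - p) (q + p) (companion e)) := by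
  refine ⟨?_, halfRot_injective.injOn, ?_⟩
  · rintro x ⟨i, hx⟩
    exact ⟨i + 1, halfRot_mem_perfectCycle.2 hx⟩
  · rintro x ⟨i, hx⟩
    rw [← sub_add_cancel i 1, perfectCycle_companion_add_one, List.mem_map] at hx
    obtain ⟨y, hy, rfl⟩ := hx
    exact ⟨y, ⟨_, hy⟩, rfl⟩

theorem IsFormalMoveGraph.equivalent_companion {e : List LiftType} {Φ Ψ : DirectionGraph}
    (hΦ : IsFormalMoveGraph e Φ) (hΨ : IsFormalMoveGraph (companion e) Ψ) : Φ.Equivalent Ψ := by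
  obtain ⟨σ, hσ⟩ := (isMoveGraph_iff_formal (p := 1) (q := 2) (by norm_num) (by norm_num)).2 hΦ
  obtain ⟨τ, hτ⟩ :=
    (isMoveGraph_iff_formal (p := 2 - 1) (q := 2 + 1) (by norm_num) (by norm_num)).2 hΨ
  let ρ := (halfRot_bijOn (1 : ℤ) 2 e).equiv
  have hρ (a) : (ρ a : ℤ × ℤ) = halfRot a := rfl
  refine ⟨Equiv.addRight 1, isEquivalencePerm_addRight_one, (σ.symm.trans ρ).trans τ, ?_⟩
  refine σ.forall_congr_right.1 fun a => forall_comm.1 (σ.forall_congr_right.1 fun b i => ?_)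
  simp only [Equiv.trans_apply, Equiv.symm_apply_apply, Equiv.coe_addRight, ← hσ, ← hτ, hρ,
    ← halfRot_stepVec, ← halfRot_add, halfRot_injective.eq_iff]

/-- The direction matrix of direction `i` over the reals. -/
abbrev realDir (i : SkewDir) : Matrix (Fin 2) (Fin 2) ℝ := (dirMatrix i).map (fun z : ℤ => (z : ℝ))

theorem realDir_injective : Function.Injective realDir :=
  (Matrix.map_injective Int.cast_injective).comp dirMatrix_injective

theorem det_realDir (i : SkewDir) : (realDir i).det = if i.val % 2 = 0 then -1 else 1 := by
  fin_cases i <;> simp [realDir, dirMatrix, Matrix.det_fin_two]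

theorem realDir_one : realDir 1 = 1 := by
  ext a b
  fin_cases a <;> fin_cases b <;> simp [realDir, dirMatrix]

theorem isUnit_det_of_realDir {π : Equiv.Perm SkewDir} {P Q : Matrix (Fin 2) (Fin 2) ℝ}
    (h : ∀ i, realDir (π i) = P * realDir i * Q) : IsUnit P.det ∧ IsUnit Q.det := by
  have hdet := congrArg Matrix.det (h 1)
  rw [realDir_one, mul_one, Matrix.det_mul, det_realDir] at hdet
  have hne : P.det * Q.det ≠ 0 := by
    rw [← hdet]; split_ifs <;> norm_num
  exact ⟨(left_ne_zero_of_mul hne).isUnit, (right_ne_zero_of_mul hne).isUnit⟩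

theorem isEquivalencePerm_refl : IsEquivalencePerm (Equiv.refl _) :=
  ⟨1, 1, fun i => by rw [one_mul, mul_one, Equiv.refl_apply]⟩

theorem IsEquivalencePerm.trans {π ρ : Equiv.Perm SkewDir} (h : IsEquivalencePerm π)
    (h' : IsEquivalencePerm ρ) : IsEquivalencePerm (π.trans ρ) := by
  obtain ⟨P, Q, h⟩ := h
  obtain ⟨P', Q', h'⟩ := h'
  exact ⟨P' * P, Q * Q', fun i => by rw [Equiv.trans_apply, h', h]; simp only [Matrix.mul_assoc]⟩

theorem IsEquivalencePerm.symm {π : Equiv.Perm SkewDir} (h : IsEquivalencePerm π) :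
    IsEquivalencePerm π.symm := by
  obtain ⟨P, Q, h⟩ := h
  obtain ⟨hP, hQ⟩ := isUnit_det_of_realDir h
  refine ⟨P⁻¹, Q⁻¹, fun i => ?_⟩
  have hi := h (π.symm i)
  rw [Equiv.apply_symm_apply] at hi
  rw [hi, Matrix.mul_assoc P, Matrix.nonsing_inv_mul_cancel_left _ _ hP,
    Matrix.mul_nonsing_inv_cancel_right _ _ hQ]

theorem DirectionGraph.Coincide.equivalent {Φ Ψ : DirectionGraph} (h : Φ.Coincide Ψ) :
    Φ.Equivalent Ψ := ⟨Equiv.refl _, isEquivalencePerm_refl, h⟩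

/-! ## Counting vertices by the directions of their arcs -/

/-- The four pairings of the directions of determinant `-1` with those of determinant `1`: the
direction matrix of `partner c i` is that of `i` times a reflection which depends only on `c`. -/
def partner (c : Fin 4) (i : SkewDir) : SkewDir :=
  if i.val % 2 = 0 then i + Fin.ofNat 8 (2 * c.val + 1) else i - Fin.ofNat 8 (2 * c.val + 1)

theorem realDir_partner (c : Fin 4) (i : SkewDir) :
    realDir (partner c i) = realDir i * realDir (partner c 1) := by
  have h : dirMatrix (partner c i) = dirMatrix i * dirMatrix (partner c 1) := by
    revert c i; decide
  rw [realDir, h]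
  exact Matrix.map_mul (f := Int.castRingHom ℝ)

theorem exists_eq_partner {i j : SkewDir} (h : (realDir i).det ≠ (realDir j).det) :
    ∃ c, j = partner c i := by
  have hpartner : ∀ i j : SkewDir, i.val % 2 ≠ j.val % 2 → ∃ c, j = partner c i := by decide
  refine hpartner i j fun hij => h ?_
  rw [det_realDir, det_realDir, hij]

theorem IsEquivalencePerm.exists_partner {π : Equiv.Perm SkewDir} (h : IsEquivalencePerm π)
    (c : Fin 4) : ∃ d, ∀ i, π (partner c i) = partner d (π i) := by
  obtain ⟨P, Q, h⟩ := h
  replace h (i) : realDir (π i) = P * realDir i * Q := h i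
  obtain ⟨hP, hQ⟩ := isUnit_det_of_realDir h
  obtain ⟨d, hd⟩ : ∃ d, π (partner c 1) = partner d (π 1) := by
    apply exists_eq_partner
    have hdet : (realDir (partner c 1)).det = -1 := by
      rw [det_realDir, if_pos]
      revert c; decide
    rw [h, h, Matrix.det_mul, Matrix.det_mul, Matrix.det_mul, Matrix.det_mul, hdet, realDir_one,
      Matrix.det_one]
    have := mul_ne_zero hP.ne_zero hQ.ne_zero
    grind
  have hreflection : realDir (partner c 1) * Q = Q * realDir (partner d 1) := by
    have hdir := h (partner c 1)
    rw [hd, realDir_partner, h 1, realDir_one, mul_one, Matrix.mul_assoc, Matrix.mul_assoc] at hdir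
    have := congrArg (P⁻¹ * ·) hdir
    simpa only [Matrix.nonsing_inv_mul_cancel_left _ _ hP] using this.symm
  refine ⟨d, fun i => realDir_injective ?_⟩
  rw [h, realDir_partner, realDir_partner d, h i, Matrix.mul_assoc P, Matrix.mul_assoc (realDir i),
    hreflection, ← Matrix.mul_assoc, ← Matrix.mul_assoc]

theorem IsEquivalencePerm.exists_perm {π : Equiv.Perm SkewDir} (h : IsEquivalencePerm π) :
    ∃ τ : Equiv.Perm (Fin 4), ∀ c i, π (partner c i) = partner (τ c) (π i) := by
  choose τ hτ using h.exists_partner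
  have partner_injective : ∀ c d : Fin 4, partner c 1 = partner d 1 → c = d := by decide
  have hinj : Function.Injective τ := fun c d hcd =>
    partner_injective _ _ (π.injective (by rw [hτ, hτ, hcd]))
  exact ⟨.ofBijective τ (Finite.injective_iff_bijective.1 hinj), hτ⟩

/-- The number of vertices with two outgoing arcs whose directions are paired by `partner c`. -/
noncomputable def DirectionGraph.pairCount (Φ : DirectionGraph) (c : Fin 4) : ℕ :=
  Nat.card {x : Φ.V // ∃ i, (∃ y, Φ.Arc x i y) ∧ ∃ y, Φ.Arc x (partner c i) y}

theorem pairCount_eq_of_relabeling {Φ Ψ : DirectionGraph} (π : Equiv.Perm SkewDir)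
    (τ : Equiv.Perm (Fin 4)) (hτ : ∀ c i, π (partner c i) = partner (τ c) (π i))
    (σ : Φ.V ≃ Ψ.V) (h : ∀ x i y, Φ.Arc x i y ↔ Ψ.Arc (σ x) (π i) (σ y)) (c : Fin 4) :
    Φ.pairCount c = Ψ.pairCount (τ c) := by
  have harc (x i) : (∃ y, Φ.Arc x i y) ↔ ∃ y, Ψ.Arc (σ x) (π i) y := by
    simp only [h, σ.surjective.exists]
  refine Nat.card_congr (σ.subtypeEquiv fun x => Iff.trans ?_ π.surjective.exists.symm)
  simp only [harc, hτ]

theorem DirectionGraph.Coincide.pairCount_eq {Φ Ψ : DirectionGraph} (h : Φ.Coincide Ψ) :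
    Φ.pairCount = Ψ.pairCount := by
  obtain ⟨σ, hσ⟩ := h
  funext c
  exact pairCount_eq_of_relabeling (.refl _) (.refl _) (fun _ _ => rfl) σ hσ c

/-- The four values of `pairCount`: an invariant of a direction graph up to equivalence. -/
noncomputable def DirectionGraph.pairCounts (Φ : DirectionGraph) : Multiset ℕ :=
  Finset.univ.val.map Φ.pairCount

theorem DirectionGraph.Equivalent.pairCounts_eq {Φ Ψ : DirectionGraph} (h : Φ.Equivalent Ψ) :
    Φ.pairCounts = Ψ.pairCounts := by
  obtain ⟨π, hπ, σ, hσ⟩ := h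
  obtain ⟨τ, hτ⟩ := hπ.exists_perm
  have hcount : Φ.pairCount = Ψ.pairCount ∘ τ :=
    funext (pairCount_eq_of_relabeling π τ hτ σ hσ)
  rw [pairCounts, pairCounts, hcount, ← Multiset.map_map, Multiset.map_univ_val_equiv]

/-! ## The counts determine the descent -/

/-- The effect of a lift on the numbers of squares in the sections `E` and `NE`. -/
def countStep (t : LiftType) (v : ℕ × ℕ) : ℕ × ℕ :=
  match t with
  | .f => (v.1 + 2 * v.2, v.2)
  | .g => (v.1, 2 * v.1 + v.2)
  | .h => (3 * v.1 + 2 * v.2, 2 * v.1 + v.2)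
  | .hbar => (v.1 + 2 * v.2, 2 * v.1 + 3 * v.2)

/-- The effect of a string of lifts on the numbers of squares in the sections `E` and `NE`. -/
def counts (e : List LiftType) (v : ℕ × ℕ) : ℕ × ℕ := e.foldr countStep v

theorem counts_pos (e : List LiftType) : 0 < (counts e (1, 1)).1 ∧ 0 < (counts e (1, 1)).2 := by
  induction e with
  | nil => simp [counts]
  | cons t e ih =>
    simp only [counts, List.foldr_cons] at ih ⊢
    cases t <;> simp only [countStep] <;> omega

theorem countStep_ne_one (t : LiftType) {v : ℕ × ℕ} (hv : 0 < v.1 ∧ 0 < v.2) :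
    countStep t v ≠ (1, 1) := by
  cases t <;> simp only [countStep, ne_eq, Prod.ext_iff] <;> omega

theorem countStep_inj {t t' : LiftType} {v v' : ℕ × ℕ} (hv : 0 < v.1 ∧ 0 < v.2)
    (hv' : 0 < v'.1 ∧ 0 < v'.2) : countStep t v = countStep t' v' ↔ t = t' ∧ v = v' := by
  cases t <;> cases t' <;>
    simp only [countStep, Prod.ext_iff, reduceCtorEq, true_and, false_and, iff_false] <;> omega

theorem counts_one_injective : Function.Injective (counts · (1, 1)) := by
  intro e
  induction e with
  | nil =>
    rintro (_ | ⟨t, e'⟩) h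
    · rfl
    · exact absurd h.symm (countStep_ne_one t (counts_pos e'))
  | cons t e ih =>
    rintro (_ | ⟨t', e'⟩) h
    · exact absurd h (countStep_ne_one t (counts_pos e))
    · obtain ⟨ht, he⟩ := (countStep_inj (counts_pos e) (counts_pos e')).1 h
      rw [ht, ih he]

theorem counts_companion (e : List LiftType) (v : ℕ × ℕ) :
    counts (companion e) v.swap = (counts e v).swap := by
  induction e with
  | nil => rfl
  | cons t e ih =>
    simp only [counts, companion, List.map_cons, List.foldr_cons] at ih ⊢
    rw [ih]
    cases t <;> simp [LiftType.companion, countStep, add_comm]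

/-- The values of `pairCount` on a fundamental direction cycle of descent `e`. -/
def countMultiset (e : List LiftType) : Multiset ℕ :=
  {4 * (counts e (1, 1)).2, 0, 0, 4 * (counts e (1, 1)).1}

theorem eq_or_companion_of_countMultiset {e e' : List LiftType}
    (h : countMultiset e = countMultiset e') : e = e' ∨ e' = companion e := by
  have hne (e) : (counts e (1, 1)).1 ≠ 0 ∧ (counts e (1, 1)).2 ≠ 0 :=
    ⟨(counts_pos e).1.ne', (counts_pos e).2.ne'⟩
  have hpair : ({(counts e (1, 1)).2, (counts e (1, 1)).1} : Multiset ℕ) =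
      {(counts e' (1, 1)).2, (counts e' (1, 1)).1} := by
    have := congrArg (Multiset.map (· / 4) ∘ Multiset.filter (· ≠ 0)) h
    simpa [countMultiset, Multiset.filter_singleton, hne] using this
  rcases Multiset.cons_eq_cons.1 hpair with ⟨h2, h1⟩ | ⟨-, s, h1, h2⟩
  · exact .inl (counts_one_injective (Prod.ext (Multiset.singleton_inj.1 h1) h2))
  · refine .inr (counts_one_injective ?_)
    have := counts_companion e (1, 1)
    rw [Prod.swap_prod_mk] at this
    exact (this.trans (Prod.ext ((Multiset.singleton_eq_cons_iff s).1 h2).1.symm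
      ((Multiset.singleton_eq_cons_iff s).1 h1).1)).symm

theorem length_liftPieces {t : LiftType} {a : Fin 8 → List X} {v : ℕ × ℕ}
    (h : ∀ i, (a i).length = if i.val % 2 = 0 then v.1 else v.2) (i : Fin 8) :
    (liftPieces t a i).length = if i.val % 2 = 0 then (countStep t v).1 else (countStep t v).2 := by
  have neg_one : (-1 : Fin 8) = 7 := rfl
  have neg_two : (-2 : Fin 8) = 6 := rfl
  fin_cases i <;> cases t <;>
    simp [neg_one, neg_two, liftPieces, triple, quintuple, LiftType.companion, h, countStep] <;>
      ring

theorem length_perfectCycle (p q : A) (e : List LiftType) (i : Fin 8) :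
    (perfectCycle p q e i).length =
      if i.val % 2 = 0 then (counts e (1, 1)).1 else (counts e (1, 1)).2 := by
  induction e generalizing i with
  | nil => simp [perfectCycle, counts]
  | cons t e ih =>
    rw [perfectCycle, List.length_map]
    exact length_liftPieces ih i

theorem card_mem_list {l : List X} (h : l.Nodup) : Nat.card {x // x ∈ l} = l.length := by
  classical
  rw [Nat.card_congr (List.Nodup.getEquiv l h).symm, Nat.card_fin]

/-- The pairing of the two directions `k + 3` and `k + 4` of the arcs out of section `k`. -/
def sectionPairing (k : Fin 8) : Fin 4 := if k.val % 2 = 0 then 3 else 0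

theorem exists_partner_iff_sectionPairing : ∀ (c : Fin 4) (k : Fin 8),
    (∃ i, (i = k + 3 ∨ i = k + 4) ∧ (partner c i = k + 3 ∨ partner c i = k + 4)) ↔
      sectionPairing k = c := by
  decide

theorem exists_eq_add_stepVec_iff {p q : ℤ} (hp : 0 < p) (hpq : p < q) {e : List LiftType}
    {k i : Fin 8} {x : Square} (hx : x ∈ perfectCycle p q e k) :
    (∃ y : squareSet p q e, y.1 = x + stepVec p q e i) ↔ i = k + 3 ∨ i = k + 4 :=
  ⟨fun ⟨⟨_, _, hy⟩, h⟩ => eq_or_eq_of_add_stepVec_mem hp hpq hx (by rwa [← h]),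
    fun hi => ⟨⟨_, add_stepVec_mem_squareSet hx hi⟩, rfl⟩⟩

theorem IsMoveGraph.pairCount_eq_length {p q : ℤ} (hp : 0 < p) (hpq : p < q) {e : List LiftType}
    {Φ : DirectionGraph} (hΦ : IsMoveGraph p q e Φ) (c : Fin 4) :
    Φ.pairCount c = (((List.finRange 8).filter (sectionPairing · = c)).flatMap
      (perfectCycle p q e)).length := by
  obtain ⟨σ, hσ⟩ := hΦ
  have harc (x : squareSet p q e) (i) :
      (∃ y, Φ.Arc (σ x) i y) ↔ ∃ y : squareSet p q e, y.1 = x + stepVec p q e i := by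
    simp only [σ.surjective.exists, hσ]
  have hmem (x : squareSet p q e) :
      x.1 ∈ ((List.finRange 8).filter (sectionPairing · = c)).flatMap (perfectCycle p q e) ↔
        ∃ i, (∃ y, Φ.Arc (σ x) i y) ∧ ∃ y, Φ.Arc (σ x) (partner c i) y := by
    obtain ⟨x, k, hk⟩ := x
    simp only [harc, exists_eq_add_stepVec_iff hp hpq hk, exists_partner_iff_sectionPairing,
      List.mem_flatMap, List.mem_filter, List.mem_finRange, true_and, decide_eq_true_eq]
    exact ⟨fun ⟨j, hj, hxj⟩ => section_unique hp hpq hk hxj ▸ hj, fun hc => ⟨k, hc, hk⟩⟩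
  rw [← card_mem_list ((squares_nodup hp hpq e).sublist
    (List.Sublist.flatMap List.filter_sublist _)), DirectionGraph.pairCount]
  refine (Nat.card_congr (σ.subtypeEquiv hmem)).symm.trans
    (Nat.card_congr (Equiv.subtypeSubtypeEquivSubtype fun {x} hx => ?_))
  obtain ⟨k, -, hk⟩ := List.mem_flatMap.1 hx
  exact ⟨k, hk⟩

theorem IsFormalMoveGraph.pairCount_eq {e : List LiftType} {Φ : DirectionGraph}
    (hΦ : IsFormalMoveGraph e Φ) :
    Φ.pairCount = ![4 * (counts e (1, 1)).2, 0, 0, 4 * (counts e (1, 1)).1] := by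
  have hΦ : IsMoveGraph (1 : ℤ) 2 e Φ := (isMoveGraph_iff_formal (by norm_num) (by norm_num)).2 hΦ
  have hsections : ∀ c, (List.finRange 8).filter (sectionPairing · = c) =
      ![[1, 3, 5, 7], [], [], [0, 2, 4, 6]] c := by decide
  funext c
  rw [hΦ.pairCount_eq_length (by norm_num) (by norm_num), hsections]
  fin_cases c <;> simp [length_perfectCycle] <;> ring

theorem IsFormalMoveGraph.pairCounts_eq {e : List LiftType} {Φ : DirectionGraph}
    (hΦ : IsFormalMoveGraph e Φ) : Φ.pairCounts = countMultiset e := by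
  rw [DirectionGraph.pairCounts, hΦ.pairCount_eq]
  rfl

theorem IsFormalMoveGraph.eq_of_coincide {e e' : List LiftType} {Φ Ψ : DirectionGraph}
    (hΦ : IsFormalMoveGraph e Φ) (hΨ : IsFormalMoveGraph e' Ψ) (h : Φ.Coincide Ψ) : e = e' := by
  have hcount := h.pairCount_eq
  rw [hΦ.pairCount_eq, hΨ.pairCount_eq] at hcount
  simp only [Matrix.vecCons_inj, true_and, mul_right_inj' four_ne_zero, and_true] at hcount
  exact counts_one_injective (Prod.ext hcount.2 hcount.1)

/-! ## The directions of the successive moves of a cycle -/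

/-- `IsWalk w x l y a`: the walk from `x` whose successive steps are `w k` for the letters `k` of
`l` visits the list `a` and ends at `y`. -/
inductive IsWalk (w : X → A) : A → List X → A → List A → Prop
  | single (x : A) : IsWalk w x [] x [x]
  | cons {x y : A} {k : X} {l : List X} {a : List A} :
      IsWalk w (x + w k) l y a → IsWalk w x (k :: l) y (x :: a)

namespace IsWalk

variable {w : X → A} {x y x' y' : A} {k : X} {l l' : List X} {a a' : List A}

theorem append (h : IsWalk w x l y a) (hk : y + w k = x') (h' : IsWalk w x' l' y' a') :
    IsWalk w x (l ++ k :: l') y' (a ++ a') := by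
  induction h with
  | single => exact cons (hk ▸ h')
  | cons _ ih => exact cons (ih hk)

theorem map_add_right (h : IsWalk w x l y a) (v : A) :
    IsWalk w (x + v) l (y + v) (a.map (· + v)) := by
  induction h with
  | single => exact single _
  | cons _ ih =>
    rw [add_right_comm] at ih
    exact cons ih

theorem reverse (h : IsWalk w x l y a) (op : X → X) (hop : ∀ k, w (op k) = -w k) :
    IsWalk w y (l.map op).reverse x a.reverse := by
  induction h with
  | single => exact single _
  | cons _ ih =>
    rw [List.map_cons, List.reverse_cons, List.reverse_cons]
    exact ih.append (by rw [hop, add_neg_cancel_right]) (single _)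

theorem length_eq (h : IsWalk w x l y a) : a.length = l.length + 1 := by
  induction h with
  | single => rfl
  | cons _ ih => rw [List.length_cons, List.length_cons, ih]

theorem getElem_zero (h : IsWalk w x l y a) (h0 : 0 < a.length) : a[0] = x := by
  cases h <;> rfl

theorem getElem_succ (h : IsWalk w x l y a) {n : ℕ} (hn : n < l.length)
    (hn' : n + 1 < a.length) : a[n + 1] = a[n] + w l[n] := by
  induction h generalizing n with
  | single => exact absurd hn (Nat.not_lt_zero _)
  | cons h ih =>
    cases n with
    | zero => exact h.getElem_zero _
    | succ n => exact ih (Nat.lt_of_succ_lt_succ hn) (Nat.lt_of_succ_lt_succ hn')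

theorem length_eq_of_closed (h : IsWalk w x l x (a ++ [x])) : a.length = l.length := by
  simpa using h.length_eq

theorem getElem_mod_of_closed (h : IsWalk w x l x (a ++ [x])) {n : ℕ} (hn : n < a.length)
    (hl : n < l.length) (hn' : (n + 1) % a.length < a.length) :
    a[(n + 1) % a.length] = a[n] + w l[n] := by
  have hstep := h.getElem_succ hl (by simpa using hn)
  rw [List.getElem_append_left hn] at hstep
  rw [← hstep]
  rcases Nat.lt_or_ge (n + 1) a.length with hlt | hge
  · rw [List.getElem_append_left hlt]
    congr 1
    exact Nat.mod_eq_of_lt hlt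
  · have heq : n + 1 = a.length := le_antisymm hn hge
    have h0 := h.getElem_zero (by simp)
    rw [List.getElem_append_left (by omega)] at h0
    simp [heq, h0]

end IsWalk

/-- The word along `triple`: `L i` is the word along the path `a^i`, and `J i` is the direction of
the move from the end of `a^i` to the beginning of the next path. -/
def tripleWord (L : Fin 8 → List (Fin 8)) (J : Fin 8 → Fin 8) (i : Fin 8) : List (Fin 8) :=
  L (i - 1) ++ J (i - 1) :: (L i ++ J i :: L (i + 1))

/-- The word along `quintuple`. -/
def quintupleWord (L : Fin 8 → List (Fin 8)) (J : Fin 8 → Fin 8) (i : Fin 8) : List (Fin 8) :=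
  L (i - 2) ++ J (i - 2) :: (tripleWord L J i ++ J (i + 1) :: L (i + 2))

/-- The words along the paths of a lift of type `t`. Reversing a path adds `4` to the letters of its
word, which the opposite section undoes. -/
def liftWord (t : LiftType) (L : Fin 8 → List (Fin 8)) (J : Fin 8 → Fin 8) (i : Fin 8) :
    List (Fin 8) :=
  match if i.val % 2 = 0 then t else t.companion with
  | .f => (tripleWord L J i).reverse
  | .g => L i
  | .h => (quintupleWord L J i).reverse
  | .hbar => tripleWord L J i

/-- The directions of the moves between the paths of a lift of type `t`. -/
def liftJunction (t : LiftType) (J : Fin 8 → Fin 8) (i : Fin 8) : Fin 8 :=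
  match if i.val % 2 = 0 then t else t.companion with
  | .f | .g => J i
  | .h => J (i - 1)
  | .hbar => J (i + 1)

/-- The direction, up to `startPerm`, of the move of `D^M_o(e)` from the path `i` to the next. -/
def junction : List LiftType → Fin 8 → Fin 8
  | [], i => i
  | t :: e, i => liftJunction t (junction e) i

/-- The directions, up to `startPerm`, of the moves of `D^M_o(e)` along the path `i`. -/
def pathWord : List LiftType → Fin 8 → List (Fin 8)
  | [], _ => []
  | t :: e, i => liftWord t (pathWord e) (junction e) i

theorem junction_companion_add_one (e : List LiftType) (i : Fin 8) :
    junction (companion e) (i + 1) = junction e i + 1 := by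
  induction e generalizing i with
  | nil => rfl
  | cons t e ih =>
    rw [companion, List.map_cons, ← companion, junction, junction]
    cases t <;> by_cases hi : i.val % 2 = 0 <;>
      simp only [liftJunction, val_add_one_mod_two, LiftType.companion, hi, if_true, if_false,
        not_true, not_false_iff, ← ih, add_sub_right_comm i 1]

theorem junction_add_two (e : List LiftType) (i : Fin 8) :
    junction e (i + 2) = junction e i + 2 := by
  have htwo (j : Fin 8) : j + 2 = j + 1 + 1 := by rw [add_assoc]; rfl
  conv_lhs => rw [← companion_companion e]
  rw [htwo, htwo, junction_companion_add_one, junction_companion_add_one]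

theorem pathWord_companion_add_one (e : List LiftType) (i : Fin 8) :
    pathWord (companion e) (i + 1) = (pathWord e i).map (· + 1) := by
  induction e generalizing i with
  | nil => rfl
  | cons t e ih =>
    have hadd (j : Fin 8) : i + 1 + j = i + j + 1 := add_right_comm i 1 j
    rw [companion, List.map_cons, ← companion, pathWord, pathWord]
    cases t <;> by_cases hi : i.val % 2 = 0 <;>
      simp only [liftWord, tripleWord, quintupleWord, val_add_one_mod_two, LiftType.companion, hi,
        if_true, if_false, not_true, not_false_iff, List.map_reverse, List.map_append,
        List.map_cons, ← ih, ← junction_companion_add_one, add_sub_right_comm i 1, hadd]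

theorem pathWord_add_two (e : List LiftType) (i : Fin 8) :
    pathWord e (i + 2) = (pathWord e i).map (· + 2) := by
  have htwo (j : Fin 8) : j + 2 = j + 1 + 1 := by rw [add_assoc]; rfl
  conv_lhs => rw [← companion_companion e]
  rw [htwo, pathWord_companion_add_one, pathWord_companion_add_one, List.map_map]
  exact List.map_congr_left fun j _ => (htwo j).symm

theorem junction_add_four (e : List LiftType) (i : Fin 8) :
    junction e (i + 4) = junction e i + 4 := by
  have hfour (j : Fin 8) : j + 4 = j + 2 + 2 := by rw [add_assoc]; rfl
  rw [hfour, hfour, junction_add_two, junction_add_two]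

theorem pathWord_add_four (e : List LiftType) (i : Fin 8) :
    pathWord e (i + 4) = (pathWord e i).map (· + 4) := by
  have hfour (j : Fin 8) : j + 4 = j + 2 + 2 := by rw [add_assoc]; rfl
  rw [hfour, pathWord_add_two, pathWord_add_two, List.map_map]
  exact List.map_congr_left fun j _ => (hfour j).symm

/-- The moves of the cycles `D^M_o(e)`: here `(p, q)` are the first parameters, so that the
proportions of `M` are `q - 2p` and `p` up to order and sign. -/
def baseMove (p q : A) (k : Fin 8) : A × A := moveVec (q - p - p) p (k + 2)

theorem baseMove_add_four (p q : A) (k : Fin 8) : baseMove p q (k + 4) = -baseMove p q k := by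
  rw [baseMove, add_right_comm, moveVec_add_four, baseMove]

theorem compassVec_liftCoeff_add_three (t : LiftType) (p q : A) (i : Fin 8) :
    compassVec (i + 3) (liftCoeff t p q (i + 3)) = compassVec i (liftCoeff t p q i) +
      moveVec (nextParams t p q).1 (nextParams t p q).2 (i + 3) := by
  fin_cases i <;> cases t <;>
    simp [compassVec, compass, liftCoeff, moveVec, nextParams, dirMatrix] <;> abel

/-- The direction of the translation between the paths `i` and `i + 1` of a lift of type `t`. -/
def liftMove (t : LiftType) (i : Fin 8) : Fin 8 :=
  match if i.val % 2 = 0 then t else t.companion with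
  | .f => i + 3
  | .g => i + 1
  | .h | .hbar => i + 2

theorem compassVec_liftCoeff_add_one (t : LiftType) (p q : A) (i : Fin 8) :
    compassVec (i + 1) (liftCoeff t p q (i + 1)) =
      compassVec i (liftCoeff t p q i) + moveVec p q (liftMove t i) := by
  fin_cases i <;> cases t <;>
    simp [compassVec, compass, liftCoeff, moveVec, dirMatrix, liftMove, LiftType.companion] <;> abel

section Lift

variable {w : Fin 8 → A} {L : Fin 8 → List (Fin 8)} {J : Fin 8 → Fin 8} {entry exit : Fin 8 → A}
  {a : Fin 8 → List A}

theorem isWalk_tripleWord (walk : ∀ i, IsWalk w (entry i) (L i) (exit i) (a i))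
    (next : ∀ i, exit i + w (J i) = entry (i + 1)) (i : Fin 8) :
    IsWalk w (entry (i - 1)) (tripleWord L J i) (exit (i + 1)) (triple a i) := by
  rw [tripleWord, triple, List.append_assoc]
  refine (walk _).append ?_ ((walk i).append (next i) (walk _))
  rw [next, sub_add_cancel]

theorem isWalk_quintupleWord (walk : ∀ i, IsWalk w (entry i) (L i) (exit i) (a i))
    (next : ∀ i, exit i + w (J i) = entry (i + 1)) (i : Fin 8) :
    IsWalk w (entry (i - 2)) (quintupleWord L J i) (exit (i + 2)) (quintuple a i) := by
  have hquintuple : quintuple a i = a (i - 2) ++ (triple a i ++ a (i + 2)) := by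
    simp only [quintuple, triple, List.append_assoc]
  rw [quintupleWord, hquintuple]
  refine (walk _).append ?_ ((isWalk_tripleWord walk next i).append ?_ (walk _))
  · rw [next, sub_add]; rfl
  · rw [next, add_assoc]; rfl

/-- The first square of the path `i` of a lift of type `t` before translation, where `entry` and
`exit` are the ends of the paths of the cycle which is lifted. -/
def liftEntry (t : LiftType) (entry exit : Fin 8 → X) (i : Fin 8) : X :=
  match if i.val % 2 = 0 then t else t.companion with
  | .f => exit (i + 5)
  | .g => entry i
  | .h => exit (i + 6)
  | .hbar => entry (i - 1)

/-- The last square of the path `i` of a lift of type `t` before translation. -/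
def liftExit (t : LiftType) (entry exit : Fin 8 → X) (i : Fin 8) : X :=
  match if i.val % 2 = 0 then t else t.companion with
  | .f => entry (i + 3)
  | .g => exit i
  | .h => entry (i + 2)
  | .hbar => exit (i + 1)

theorem isWalk_liftWord (t : LiftType) (hw : ∀ k, w (k + 4) = -w k)
    (hL : ∀ i, L (i + 4) = (L i).map (· + 4)) (hJ : ∀ i, J (i + 4) = J i + 4)
    (walk : ∀ i, IsWalk w (entry i) (L i) (exit i) (a i))
    (next : ∀ i, exit i + w (J i) = entry (i + 1)) (i : Fin 8) :
    IsWalk w (liftEntry t entry exit i) (liftWord t L J i) (liftExit t entry exit i)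
      (liftPieces t a i) := by
  have hfour (j : Fin 8) : j + 4 + 4 = j := by rw [add_assoc]; exact add_zero j
  have hadd (j : Fin 8) : i + 4 + j = i + j + 4 := add_right_comm i 4 j
  have hsub (j : Fin 8) : i + 4 - j = i - j + 4 := add_sub_right_comm i 4 j
  have htriple : (tripleWord L J (i + 4)).map (· + 4) = tripleWord L J i := by
    simp [tripleWord, hadd, hsub, hL, hJ, hfour, Function.comp_def]
  have hquintuple : (quintupleWord L J (i + 4)).map (· + 4) = quintupleWord L J i := by
    simp [quintupleWord, htriple, hadd, hsub, hL, hJ, hfour, Function.comp_def]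
  have walk3 (j) := isWalk_tripleWord walk next j
  have walk5 (j) := isWalk_quintupleWord walk next j
  unfold liftEntry liftWord liftExit liftPieces
  generalize (if i.val % 2 = 0 then t else t.companion) = u
  cases u with
  | f =>
    have := (walk3 (i + 4)).reverse (· + 4) hw
    rw [htriple, add_assoc i 4 1, add_sub_assoc i 4 1] at this
    exact this
  | g => exact walk i
  | h =>
    have := (walk5 (i + 4)).reverse (· + 4) hw
    rw [hquintuple, add_assoc i 4 2, add_sub_assoc i 4 2] at this
    exact this
  | hbar => exact walk3 i

theorem liftExit_eq_liftEntry (t : LiftType) (entry exit : Fin 8 → X) (i : Fin 8) :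
    liftExit t entry exit i = liftEntry t entry exit (i + 3) := by
  fin_cases i <;> cases t <;> rfl

theorem liftExit_add_liftJunction (t : LiftType) {s : Fin 8 → A}
    (next : ∀ i, exit i + w (J i) = entry (i + 1)) (skip : ∀ i, exit i + s (i + 3) = entry (i + 3))
    (i : Fin 8) :
    liftExit t entry exit i + w (liftJunction t J i) = liftEntry t entry exit (i + 1) +
      s (liftMove t i) := by
  have hu : (if (i + 1).val % 2 = 0 then t else t.companion) =
      (if i.val % 2 = 0 then t else t.companion).companion := by
    by_cases hi : i.val % 2 = 0 <;>
      simp only [hi, val_add_one_mod_two, not_true, not_false_iff, if_true, if_false,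
        LiftType.companion_companion]
  have hadd (j k : Fin 8) : i + 1 + j + k = i + (1 + j + k) := by simp only [add_assoc]
  unfold liftExit liftEntry liftJunction liftMove
  rw [hu]
  generalize (if i.val % 2 = 0 then t else t.companion) = u
  cases u <;> dsimp only [LiftType.companion]
  case f => rw [← skip, ← next, add_right_comm]
  case g =>
    have := skip (i + 1 + 5)
    rw [hadd] at this
    exact (next i).trans this.symm
  case h =>
    have htwo : i - 1 + 3 = i + 2 := by rw [sub_add_eq_add_sub, add_sub_assoc]; rfl
    have hskip := skip (i - 1)
    have hnext := next (i - 1)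
    rw [htwo] at hskip
    rw [sub_add_eq_add_sub] at hnext
    rw [← hskip, ← hnext, add_right_comm]
  case hbar =>
    have := skip (i + 1 + 6)
    rw [hadd] at this
    rw [next, add_assoc i 1 1]
    exact this.symm

end Lift

theorem exists_isWalk_pathWord (p q : A) (e : List LiftType) :
    ∃ entry exit : Fin 8 → A × A, ∀ i,
      IsWalk (baseMove p q) (entry i) (pathWord e i) (exit i) (perfectCycle p q e i) ∧
      exit i + baseMove p q (junction e i) = entry (i + 1) ∧
      exit i + stepVec p q e (i + 3) = entry (i + 3) := by
  induction e with
  | nil =>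
    let corner (i : Fin 8) : A × A := compassVec i (if i.val % 2 = 0 then q - p else p)
    refine ⟨corner, corner, fun i => ⟨.single _, ?_⟩⟩
    fin_cases i <;>
      simp [corner, compassVec, compass, baseMove, junction, moveVec, dirMatrix, stepVec, params]
    all_goals try abel_nf
    all_goals simp
  | cons t e ih =>
    obtain ⟨entry, exit, ih⟩ := ih
    choose walk next skip using ih
    let c (i : Fin 8) : A × A := compassVec i (liftCoeff t (params p q e).1 (params p q e).2 i)
    refine ⟨fun i => liftEntry t entry exit i + c i, fun i => liftExit t entry exit i + c i,
      fun i => ⟨?walk, ?next, ?skip⟩⟩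
    case walk =>
      exact (isWalk_liftWord t (baseMove_add_four p q) (pathWord_add_four e) (junction_add_four e)
        walk next i).map_add_right _
    case next =>
      have hc : c (i + 1) = c i + stepVec p q e (liftMove t i) :=
        compassVec_liftCoeff_add_one t _ _ i
      dsimp only
      rw [hc, junction, add_right_comm, liftExit_add_liftJunction t next skip, add_right_comm,
        add_assoc, add_comm (c i)]
    case skip =>
      dsimp only
      rw [liftExit_eq_liftEntry, add_assoc]
      exact congrArg _ (compassVec_liftCoeff_add_three t _ _ i).symm

/-- The directions, up to `startPerm`, of all moves of `D^M_o(e)`. -/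
def cycleWord (e : List LiftType) : List (Fin 8) :=
  (List.finRange 8).flatMap fun i => pathWord e i ++ [junction e i]

theorem exists_isWalk_cycleWord (p q : A) (e : List LiftType) :
    ∃ x, IsWalk (baseMove p q) x (cycleWord e) x
      ((List.finRange 8).flatMap (perfectCycle p q e) ++ [x]) := by
  obtain ⟨entry, exit, h⟩ := exists_isWalk_pathWord p q e
  choose walk next _ using h
  have key := (walk 0).append (next 0) <| (walk 1).append (next 1) <| (walk 2).append (next 2) <|
    (walk 3).append (next 3) <| (walk 4).append (next 4) <| (walk 5).append (next 5) <|
    (walk 6).append (next 6) <| (walk 7).append (next 7) <| .single _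
  refine ⟨entry 0, ?_⟩
  simpa [cycleWord, List.finRange_succ] using key

theorem cycleWord_companion (e : List LiftType) :
    ∃ m, (cycleWord (companion e)).rotate m = (cycleWord e).map (· + 1) := by
  let c (i : Fin 8) : List (Fin 8) := pathWord (companion e) i ++ [junction (companion e) i]
  have hc (i) : (pathWord e i ++ [junction e i]).map (· + 1) = c (i + 1) := by
    simp only [c, List.map_append, List.map_cons, List.map_nil, pathWord_companion_add_one,
      junction_companion_add_one]
  refine ⟨(c 0).length, ?_⟩
  rw [cycleWord, cycleWord, List.map_flatMap, funext hc]
  simp only [List.finRange_succ, List.flatMap_cons]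
  rw [List.rotate_append_length_eq]
  simp [c]

/-! ## Counting turns -/

/-- `1` if a move of direction `i` followed by one of direction `j` makes a turn such that the two
arcs out of the common square are paired by `partner c`, and `0` otherwise. -/
def turn (c : Fin 4) (i j : SkewDir) : ℕ := if partner c (i + 4) = j then 1 else 0

/-- The number of turns paired by `partner c` between successive letters of a word. -/
def turns (c : Fin 4) : List SkewDir → ℕ
  | [] | [_] => 0
  | i :: j :: l => turn c i j + turns c (j :: l)

theorem turn_comm : ∀ (c : Fin 4) (i j : SkewDir), turn c i j = turn c j i := by
  decide

theorem turn_add_one : ∀ (c : Fin 4) (i : SkewDir),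
    turn c i (i + 1) = if i.val % 2 = 0 then turn c 0 1 else turn c 1 2 := by
  decide

theorem turn_add_turn : ∀ (c : Fin 4) (i j : SkewDir),
    turn c i (i + 1) + turn c (i + 1) (i + 2) = turn c (j - 1) j + turn c j (j + 1) := by
  decide

theorem turns_append (c : Fin 4) (l : List SkewDir) (i : SkewDir) (l' : List SkewDir) :
    turns c (l ++ i :: l') = turns c (l ++ [i]) + turns c (i :: l') := by
  induction l with
  | nil => simp [turns]
  | cons j l ih =>
    obtain _ | ⟨k, l⟩ := l
    · simp [turns]
    · simp only [List.cons_append, turns] at ih ⊢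
      rw [ih, add_assoc]

theorem turns_concat (c : Fin 4) {l : List SkewDir} {i : SkewDir} (hl : l.getLast? = some i)
    (j : SkewDir) : turns c (l ++ [j]) = turns c l + turn c i j := by
  obtain ⟨l, rfl⟩ := List.getLast?_eq_some_iff.1 hl
  rw [List.append_assoc, List.singleton_append, turns_append, turns, turns, add_zero]

theorem turns_reverse (c : Fin 4) (l : List SkewDir) : turns c l.reverse = turns c l := by
  induction l with
  | nil => rfl
  | cons i l ih =>
    obtain _ | ⟨j, l⟩ := l
    · rfl
    · rw [List.reverse_cons, List.reverse_cons, List.append_assoc, List.singleton_append,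
        turns_append, ← List.reverse_cons, ih, turns, turns, turns, turn_comm, add_zero, add_comm]

/-- The word `l` fits between the letters `j` and `k`: with these letters added, its first two
letters are `j`, `j + 1`, and its last two letters are `k - 1`, `k`. Moreover, there are `n` turns
paired by `partner c` in the word `l` followed by `k`, `k + 1`. -/
structure Fits (c : Fin 4) (n : ℕ) (j : SkewDir) (l : List SkewDir) (k : SkewDir) : Prop where
  head : (l ++ [k]).head? = some (j + 1)
  last : (j :: l).getLast? = some (k - 1)
  turns : turns c (l ++ [k, k + 1]) = n

namespace Fits

variable {c : Fin 4} {n n' : ℕ} {j k m : SkewDir} {l l' : List SkewDir}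

theorem append (h : Fits c n j l k) (h' : Fits c n' k l' m) :
    Fits c (n + n') j (l ++ k :: l') m where
  head := by
    have := h.head
    cases l <;> simpa using this
  last := by
    rw [← List.cons_append, List.getLast?_append_of_ne_nil _ (List.cons_ne_nil k l'), h'.last]
  turns := by
    obtain ⟨tail, htail⟩ : ∃ tail, l' ++ [m, m + 1] = (k + 1) :: tail := by
      have := h'.head
      cases l' <;> simp_all
    have hn := h.turns
    have hn' := h'.turns
    rw [htail] at hn'
    rw [List.append_assoc, List.cons_append, htail, turns_append]
    rw [turns_append] at hn
    simp only [LeaperGraphs.turns] at hn hn' ⊢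
    omega

theorem reverse (h : Fits c n j l k) (hl : l ≠ []) : Fits c n (k - 2) l.reverse (j + 2) := by
  have hlast : l.getLast? = some (k - 1) := by
    rw [← h.last, List.getLast?_cons_of_ne_nil hl]
  have hhead : l.head? = some (j + 1) := by
    rw [← h.head, List.head?_append_of_ne_nil _ hl]
  refine ⟨?head, ?last, ?turns⟩
  case head =>
    rw [List.head?_append_of_ne_nil _ (by simpa using hl), List.head?_reverse, hlast, sub_add]
    rfl
  case last =>
    rw [List.getLast?_cons_of_ne_nil (by simpa using hl), List.getLast?_reverse, hhead,
      add_sub_assoc]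
    rfl
  case turns =>
    have hj : l.reverse.getLast? = some (j + 1) := by rw [List.getLast?_reverse, hhead]
    have hn := h.turns
    have hsum := turn_add_turn c (j + 1) k
    rw [turns_append, turns_concat c hlast] at hn
    rw [turns_append, turns_concat c hj, turns_reverse]
    rw [add_assoc, add_assoc] at hsum
    simp only [LeaperGraphs.turns, add_zero, add_assoc, Fin.reduceAdd] at hn hsum ⊢
    omega

end Fits

section Lift

variable {c : Fin 4} {n : Fin 8 → ℕ} {L : Fin 8 → List (Fin 8)} {J : Fin 8 → Fin 8}

theorem fits_tripleWord (h : ∀ i, Fits c (n i) (J (i - 1)) (L i) (J i)) (i : Fin 8) :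
    Fits c (n (i - 1) + (n i + n (i + 1))) (J (i - 2)) (tripleWord L J i) (J (i + 1)) := by
  have h1 := h (i - 1)
  have h2 := h (i + 1)
  rw [sub_sub] at h1
  rw [add_sub_cancel_right] at h2
  exact h1.append ((h i).append h2)

theorem fits_quintupleWord (h : ∀ i, Fits c (n i) (J (i - 1)) (L i) (J i)) (i : Fin 8) :
    Fits c (n (i - 2) + (n (i - 1) + (n i + n (i + 1)) + n (i + 2))) (J (i - 3))
      (quintupleWord L J i) (J (i + 2)) := by
  have h1 := h (i - 2)
  have h2 := h (i + 2)
  rw [sub_sub] at h1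
  rw [add_sub_assoc] at h2
  exact h1.append ((fits_tripleWord h i).append h2)

theorem countStep_eq_sum (t : LiftType) {v : ℕ × ℕ}
    (hn : ∀ i, n i = if i.val % 2 = 0 then v.1 else v.2) (i : Fin 8) :
    (if i.val % 2 = 0 then (countStep t v).1 else (countStep t v).2) =
      match if i.val % 2 = 0 then t else t.companion with
      | .f | .hbar => n (i - 1) + (n i + n (i + 1))
      | .g => n i
      | .h => n (i - 2) + (n (i - 1) + (n i + n (i + 1)) + n (i + 2)) := by
  have neg_one : (-1 : Fin 8) = 7 := rfl
  have neg_two : (-2 : Fin 8) = 6 := rfl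
  fin_cases i <;> cases t <;> simp [neg_one, neg_two, LiftType.companion, hn, countStep] <;> ring

theorem fits_liftWord (hJ : ∀ i, J (i + 2) = J i + 2)
    (h : ∀ i, Fits c (n i) (J (i - 1)) (L i) (J i)) (t : LiftType) {v : ℕ × ℕ}
    (hn : ∀ i, n i = if i.val % 2 = 0 then v.1 else v.2) (i : Fin 8) :
    Fits c (if i.val % 2 = 0 then (countStep t v).1 else (countStep t v).2)
      (liftJunction t J (i - 1)) (liftWord t L J i) (liftJunction t J i) := by
  have hu : (if (i - 1).val % 2 = 0 then t else t.companion) =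
      (if i.val % 2 = 0 then t else t.companion).companion := by
    have := val_add_one_mod_two (i - 1)
    rw [sub_add_cancel] at this
    by_cases hi : i.val % 2 = 0 <;> simp_all [LiftType.companion_companion]
  have hJ' {j k : Fin 8} (hjk : j + 2 = k) : J j + 2 = J k := hjk ▸ (hJ j).symm
  rw [countStep_eq_sum t hn]
  unfold liftWord liftJunction
  rw [hu]
  generalize (if i.val % 2 = 0 then t else t.companion) = u
  cases u <;> dsimp only [LiftType.companion]
  case f =>
    have := (fits_tripleWord h i).reverse (by simp [tripleWord])
    have hnext : i - 1 + 2 = i + 1 := by rw [sub_add_eq_add_sub, add_sub_assoc]; rfl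
    rw [hJ' (sub_add_cancel i 2), ← hJ' hnext, add_sub_cancel_right] at this
    exact this
  case g => exact h i
  case h =>
    have := (fits_quintupleWord h i).reverse (by simp [quintupleWord])
    have hprev : i - 3 + 2 = i - 1 := by rw [sub_add]; rfl
    rw [hJ' hprev, hJ, add_sub_cancel_right] at this
    rw [sub_add_cancel]
    exact this
  case hbar =>
    have := fits_tripleWord h i
    rw [sub_sub]
    exact this

end Lift

theorem fits_pathWord (c : Fin 4) (e : List LiftType) (i : Fin 8) :
    Fits c (if i.val % 2 = 0 then (counts e (turn c 0 1, turn c 1 2)).1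
      else (counts e (turn c 0 1, turn c 1 2)).2) (junction e (i - 1)) (pathWord e i)
      (junction e i) := by
  induction e generalizing i with
  | nil => exact ⟨by simp [pathWord, junction], rfl, by
      simp [pathWord, junction, counts, turns, turn_add_one]⟩
  | cons t e ih => exact fits_liftWord (junction_add_two e) ih t (fun _ => rfl) i

theorem turns_cycleWord (c : Fin 4) (e : List LiftType) : ∃ i, (cycleWord e).head? = some i ∧
    turns c (cycleWord e ++ [i]) = 4 * ((counts e (turn c 0 1, turn c 1 2)).1 +
      (counts e (turn c 0 1, turn c 1 2)).2) := by
  set v := counts e (turn c 0 1, turn c 1 2)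
  have even (i : Fin 8) (hi : i.val % 2 = 0) :
      Fits c v.1 (junction e (i - 1)) (pathWord e i) (junction e i) := by
    simpa only [hi, if_true] using fits_pathWord c e i
  have odd (i : Fin 8) (hi : i.val % 2 = 1) :
      Fits c v.2 (junction e (i - 1)) (pathWord e i) (junction e i) := by
    simpa only [hi, one_ne_zero, if_false] using fits_pathWord c e i
  have fits := (even 0 rfl).append <| (odd 1 rfl).append <| (even 2 rfl).append <|
    (odd 3 rfl).append <| (even 4 rfl).append <| (odd 5 rfl).append <| (even 6 rfl).append <|
    odd 7 rfl
  have neg_one : (-1 : Fin 8) = 7 := rfl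
  refine ⟨junction e 7 + 1, ?_, ?_⟩
  · simpa [cycleWord, List.finRange_succ, neg_one] using fits.head
  · have hsum : v.1 + (v.2 + (v.1 + (v.2 + (v.1 + (v.2 + (v.1 + v.2)))))) = 4 * (v.1 + v.2) := by
      ring
    simpa [cycleWord, List.finRange_succ] using fits.turns.trans hsum

/-! ## Transposed descents -/

/-- The exchange of `f` and `g`; on the matrices of `countStep` it is the transposition. -/
def LiftType.transpose : LiftType → LiftType
  | .f => .g
  | .g => .f
  | .h => .h
  | .hbar => .hbar

/-- The descent whose product of matrices of `countStep` is the transpose of the one of `e`. -/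
def transpose (e : List LiftType) : List LiftType := (e.map LiftType.transpose).reverse

theorem counts_transpose (e : List LiftType) (u v : ℕ × ℕ) :
    (counts (transpose e) u).1 * v.1 + (counts (transpose e) u).2 * v.2 =
      u.1 * (counts e v).1 + u.2 * (counts e v).2 := by
  induction e generalizing u with
  | nil => rfl
  | cons t e ih =>
    have counts_concat : counts (transpose (t :: e)) u =
        counts (transpose e) (countStep t.transpose u) := by
      simp [counts, transpose]
    rw [counts_concat, ih]
    simp only [counts, List.foldr_cons]
    cases t <;> simp only [LiftType.transpose, countStep] <;> ring

theorem h_mem_transpose {e : List LiftType} : .h ∈ transpose e ↔ .h ∈ e := by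
  rw [transpose, List.mem_reverse, List.mem_map]
  refine ⟨?_, fun h => ⟨_, h, rfl⟩⟩
  rintro ⟨_ | _ | _ | _, h, ⟨⟩⟩
  exact h

theorem hbar_mem_transpose {e : List LiftType} : .hbar ∈ transpose e ↔ .hbar ∈ e := by
  rw [transpose, List.mem_reverse, List.mem_map]
  refine ⟨?_, fun h => ⟨_, h, rfl⟩⟩
  rintro ⟨_ | _ | _ | _, h, ⟨⟩⟩
  exact h

theorem hbar_mem_companion {e : List LiftType} : .hbar ∈ companion e ↔ .h ∈ e := by
  rw [companion, List.mem_map]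
  refine ⟨?_, fun h => ⟨_, h, rfl⟩⟩
  rintro ⟨_ | _ | _ | _, h, ⟨⟩⟩
  exact h

/-! ## Direction cycles -/

/-- `Φ` is a single cycle through all of its vertices: the vertex after `a` is `next a`, and the
arc leading to it has the label `ℓ a`. -/
def IsDirectionCycle {ι : Type*} (next : Equiv.Perm ι) (ℓ : ι → SkewDir) (Φ : DirectionGraph) :
    Prop :=
  ∃ v : ι ≃ Φ.V, ∀ a i b,
    Φ.Arc (v a) i (v b) ↔ (b = next a ∧ i = ℓ a) ∨ (a = next b ∧ i = ℓ b + 4)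

namespace IsDirectionCycle

variable {ι κ : Type*} {next : Equiv.Perm ι} {next' : Equiv.Perm κ} {ℓ : ι → SkewDir}
  {ℓ' : κ → SkewDir} {Φ Ψ : DirectionGraph}

theorem equivalent (h : IsDirectionCycle next ℓ Φ) (h' : IsDirectionCycle next' ℓ' Ψ)
    {π : Equiv.Perm SkewDir} (hπ : IsEquivalencePerm π) (hπ4 : ∀ i, π (i + 4) = π i + 4)
    (ε : ι ≃ κ) (hε : ∀ a, ε (next a) = next' (ε a)) (hℓ : ∀ a, ℓ' (ε a) = π (ℓ a)) :
    Φ.Equivalent Ψ := by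
  obtain ⟨v, hv⟩ := h
  obtain ⟨v', hv'⟩ := h'
  refine ⟨π, hπ, v.symm.trans (ε.trans v'), fun x i y => ?_⟩
  obtain ⟨a, rfl⟩ := v.surjective x
  obtain ⟨b, rfl⟩ := v.surjective y
  simp only [Equiv.trans_apply, Equiv.symm_apply_apply, hv, hv', hℓ, ← hε, ← hπ4,
    EmbeddingLike.apply_eq_iff_eq]

theorem pairCount_eq_sum [Fintype ι] (h : IsDirectionCycle next ℓ Φ) (c : Fin 4) :
    Φ.pairCount c = ∑ a, turn c (ℓ a) (ℓ (next a)) := by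
  obtain ⟨v, hv⟩ := h
  have exists_arc (a i) : (∃ y, Φ.Arc (v (next a)) i y) ↔ i = ℓ (next a) ∨ i = ℓ a + 4 := by
    simp only [v.surjective.exists, hv, EmbeddingLike.apply_eq_iff_eq, exists_or,
      exists_eq_left, exists_eq_left']
  have paired : ∀ (c : Fin 4) (j k : SkewDir), (∃ i, (i = k ∨ i = j + 4) ∧
      (partner c i = k ∨ partner c i = j + 4)) ↔ partner c (j + 4) = k := by
    decide
  have hcard : Φ.pairCount c = Nat.card {a // partner c (ℓ a + 4) = ℓ (next a)} := by
    refine (Nat.card_congr ((next.trans v).subtypeEquiv fun a => ?_)).symm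
    simp only [Equiv.trans_apply, exists_arc, paired]
  simp only [hcard, Nat.card_eq_fintype_card, Fintype.card_subtype, Finset.card_filter, turn]

end IsDirectionCycle

theorem exists_isDirectionCycle {p q : A} (h : LinearIndependent ℤ ![p, q]) {ι : Type}
    (next : Equiv.Perm ι) (ℓ : ι → SkewDir) (φ : ι → A × A)
    (hφ : ∀ a, φ (next a) = φ a + moveVec p q (ℓ a)) : ∃ Φ, IsDirectionCycle next ℓ Φ := by
  refine ⟨.ofCoordinates h ι φ
    (fun a i b => (b = next a ∧ i = ℓ a) ∨ (a = next b ∧ i = ℓ b + 4)) ?_ ?_,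
    Equiv.refl _, fun _ _ _ => Iff.rfl⟩
  · rintro a _ b (⟨rfl, rfl⟩ | ⟨rfl, rfl⟩)
    · exact hφ a
    · rw [hφ, moveVec_add_four, add_neg_cancel_right]
  · rintro a b _ (⟨rfl, rfl⟩ | ⟨rfl, rfl⟩)
    · exact ⟨_, Or.inr ⟨rfl, rfl⟩⟩
    · exact ⟨_, Or.inl ⟨rfl, rfl⟩⟩

theorem turns_cons (c : Fin 4) (i : SkewDir) {l : List SkewDir} (hl : 0 < l.length) :
    turns c (i :: l) = turn c i l[0] + turns c l := by
  cases l with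
  | nil => exact absurd hl (lt_irrefl 0)
  | cons j l => rfl

theorem turns_concat_eq_sum (c : Fin 4) (l : List SkewDir) (i : SkewDir) :
    turns c (l ++ [i]) = ∑ k : Fin l.length, turn c l[k] ((l ++ [i])[k.val + 1]'(by simp)) := by
  induction l with
  | nil => rfl
  | cons j l ih =>
    calc turns c (j :: (l ++ [i]))
        = turn c j ((l ++ [i])[0]'(by simp)) + turns c (l ++ [i]) := turns_cons c j (by simp)
      _ = turn c j ((l ++ [i])[0]'(by simp)) +
          ∑ k : Fin l.length, turn c l[k] ((l ++ [i])[k.val + 1]'(by simp)) := by rw [ih]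
      _ = _ := (Fin.sum_univ_succ fun k : Fin (l.length + 1) =>
          turn c (j :: l)[k] ((j :: (l ++ [i]))[k.val + 1]'(by simpa using k.is_le))).symm

theorem coe_finRotate_eq_mod {n : ℕ} (k : Fin n) : (finRotate n k).val = (k.val + 1) % n := by
  have := k.neZero
  rw [finRotate_apply, Fin.val_add, Fin.val_one', Nat.add_mod_mod]

theorem turns_concat_head_eq_sum (c : Fin 4) {l : List SkewDir} {i : SkewDir}
    (hl : l.head? = some i) : turns c (l ++ [i]) =
      ∑ k : Fin l.length, turn c l[k] l[finRotate l.length k] := by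
  rw [turns_concat_eq_sum]
  refine Finset.sum_congr rfl fun k _ => congrArg (turn c _) ?_
  simp only [Fin.getElem_fin, coe_finRotate_eq_mod]
  rcases (Nat.succ_le_of_lt k.isLt).lt_or_eq with hlt | heq
  · simp only [Nat.succ_eq_add_one] at hlt
    simp only [List.getElem_append_left hlt, Nat.mod_eq_of_lt hlt]
  · obtain ⟨t, rfl⟩ := List.head?_eq_some_iff.1 hl
    simp only [Nat.succ_eq_add_one] at heq
    simp [heq]

/-! ## Second fundamental direction cycles -/

/-- The permutation of the directions such that the moves of `D^M_o(e)` have the directions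
`startPerm o i`, where `i` runs through `cycleWord e`. -/
def startPerm (o : OriginType) : Equiv.Perm SkewDir where
  toFun k := match o with
    | .f => if k.val % 2 = 0 then k + 3 else k + 1
    | .g => if k.val % 2 = 0 then k + 1 else k + 3
    | .h => k + 2
  invFun k := match o with
    | .f => if k.val % 2 = 0 then k - 1 else k - 3
    | .g => if k.val % 2 = 0 then k - 3 else k - 1
    | .h => k - 2
  left_inv := by cases o <;> decide
  right_inv := by cases o <;> decide

theorem startPerm_add_four (o : OriginType) (i : SkewDir) :
    startPerm o (i + 4) = startPerm o i + 4 := by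
  revert i
  cases o <;> decide

theorem startPerm_symm_add_four (o : OriginType) (i : SkewDir) :
    (startPerm o).symm (i + 4) = (startPerm o).symm i + 4 := by
  rw [Equiv.symm_apply_eq, startPerm_add_four, Equiv.apply_symm_apply]

theorem isEquivalencePerm_of_int {π : Equiv.Perm SkewDir} (P Q : Matrix (Fin 2) (Fin 2) ℤ)
    (h : ∀ i, dirMatrix (π i) = P * dirMatrix i * Q) : IsEquivalencePerm π := by
  refine ⟨P.map (Int.castRingHom ℝ), Q.map (Int.castRingHom ℝ), fun i => ?_⟩
  rw [h]
  change Matrix.map _ (Int.castRingHom ℝ) = _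
  rw [Matrix.map_mul, Matrix.map_mul]
  rfl

theorem isEquivalencePerm_startPerm (o : OriginType) : IsEquivalencePerm (startPerm o) :=
  match o with
  | .f => isEquivalencePerm_of_int !![0, -1; 1, 0] !![0, 1; 1, 0] (by decide)
  | .g => isEquivalencePerm_of_int !![0, -1; 1, 0] !![-1, 0; 0, 1] (by decide)
  | .h => isEquivalencePerm_of_int !![0, -1; 1, 0] 1 (by decide)

theorem baseMove_startParams (o : OriginType) (r s : A) (i : SkewDir) :
    baseMove (startParams o r s).1 (startParams o r s).2 i = moveVec r s (startPerm o i) := by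
  cases o <;> fin_cases i <;>
    simp [baseMove, startParams, startPerm, moveVec, dirMatrix] <;> abel

theorem length_flatMap_perfectCycle (p q : A) (e : List LiftType) :
    ((List.finRange 8).flatMap (perfectCycle p q e)).length = (cycleWord e).length := by
  obtain ⟨x, hx⟩ := exists_isWalk_cycleWord p q e
  exact hx.length_eq_of_closed

/-- The squares of the perfect cycle of descent `e` in the order in which they are visited. -/
def visit (p q : A) (e : List LiftType) (k : Fin (cycleWord e).length) : A × A :=
  ((List.finRange 8).flatMap (perfectCycle p q e))[k.val]'
    (by rw [length_flatMap_perfectCycle]; exact k.isLt)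

theorem visit_finRotate (o : OriginType) (r s : A) {e : List LiftType}
    (k : Fin (cycleWord e).length) :
    visit (startParams o r s).1 (startParams o r s).2 e (finRotate _ k) =
      visit (startParams o r s).1 (startParams o r s).2 e k +
        moveVec r s (startPerm o (cycleWord e)[k]) := by
  obtain ⟨x, hx⟩ := exists_isWalk_cycleWord (startParams o r s).1 (startParams o r s).2 e
  have hlength := length_flatMap_perfectCycle (startParams o r s).1 (startParams o r s).2 e
  rw [← baseMove_startParams]
  simp only [visit, coe_finRotate_eq_mod, ← hlength]
  exact hx.getElem_mod_of_closed (by rw [hlength]; exact k.isLt) k.isLt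
    (Nat.mod_lt _ (by rw [hlength]; exact k.pos))

theorem exists_visit_eq_iff {p q : A} {e : List LiftType} {x : A × A} :
    (∃ k, visit p q e k = x) ↔ x ∈ (List.finRange 8).flatMap (perfectCycle p q e) := by
  rw [List.mem_iff_getElem]
  constructor
  · rintro ⟨k, hk⟩
    exact ⟨k, _, hk⟩
  · rintro ⟨k, hk, h⟩
    exact ⟨⟨k, by rwa [← length_flatMap_perfectCycle p q]⟩, h⟩

theorem visit_injective {p q : ℤ} (hp : 0 < p) (hpq : p < q) (e : List LiftType) :
    Function.Injective (visit p q e) := fun _ _ h =>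
  Fin.ext ((squares_nodup hp hpq e).getElem_inj_iff.1 h)

theorem exists_successive_iff {p q : ℤ} (hp : 0 < p) (hpq : p < q) {e : List LiftType}
    {a b : Fin (cycleWord e).length} :
    (∃ k < (OctoPath.squares (perfectCycle p q e)).length,
      (OctoPath.squares (perfectCycle p q e))[k]? = some (visit p q e a) ∧
      (OctoPath.squares (perfectCycle p q e))[(k + 1) %
        (OctoPath.squares (perfectCycle p q e)).length]? = some (visit p q e b)) ↔
      b = finRotate _ a := by
  have hlength : (OctoPath.squares (perfectCycle p q e)).length = (cycleWord e).length :=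
    length_flatMap_perfectCycle p q e
  have getElem?_eq (k : Fin (cycleWord e).length) :
      (OctoPath.squares (perfectCycle p q e))[k.val]? = some (visit p q e k) :=
    List.getElem?_eq_getElem _
  simp only [hlength]
  constructor
  · rintro ⟨k, hk, ha, hb⟩
    obtain rfl : ⟨k, hk⟩ = a :=
      visit_injective hp hpq e (Option.some.inj ((getElem?_eq ⟨k, hk⟩).symm.trans ha))
    rw [← coe_finRotate_eq_mod ⟨k, hk⟩, getElem?_eq] at hb
    exact (visit_injective hp hpq e (Option.some.inj hb)).symm
  · rintro rfl
    exact ⟨a, a.isLt, getElem?_eq a, by rw [← coe_finRotate_eq_mod, getElem?_eq]⟩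

theorem moveVec_injective_of_pos {p q : ℤ} (hp : 0 < p) (hpq : p < q) :
    Function.Injective (moveVec p q) := by
  intro i j h
  fin_cases i <;> fin_cases j <;> simp [moveVec, dirMatrix] at h ⊢ <;> omega

theorem visit_finRotate_eq_iff {r s : ℤ} (hr : 0 < r) (hrs : r < s) (o : OriginType)
    {e : List LiftType} (k : Fin (cycleWord e).length) (i : SkewDir) :
    visit (startParams o r s).1 (startParams o r s).2 e (finRotate _ k) =
      visit (startParams o r s).1 (startParams o r s).2 e k + moveVec r s i ↔
      i = startPerm o (cycleWord e)[k] := by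
  rw [visit_finRotate, add_right_inj, (moveVec_injective_of_pos hr hrs).eq_iff, eq_comm]

theorem eq_visit_finRotate_add_iff {r s : ℤ} (hr : 0 < r) (hrs : r < s) (o : OriginType)
    {e : List LiftType} (k : Fin (cycleWord e).length) (i : SkewDir) :
    visit (startParams o r s).1 (startParams o r s).2 e k =
      visit (startParams o r s).1 (startParams o r s).2 e (finRotate _ k) + moveVec r s i ↔
      i = startPerm o (cycleWord e)[k] + 4 := by
  rw [visit_finRotate, add_assoc, left_eq_add, ← neg_eq_iff_add_eq_zero, ← moveVec_add_four,
    (moveVec_injective_of_pos hr hrs).eq_iff, eq_comm]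

theorem exists_equiv_cycleGraph {r s : ℤ} (hr : 0 < r) (hrs : r < s) (o : OriginType)
    (e : List LiftType) :
    ∃ ε : Fin (cycleWord e).length ≃ OctoPath.board (secondCycle r s o e), ∀ a i b,
      ((OctoPath.cycleGraph (secondCycle r s o e)).Adj (ε a) (ε b) ∧
        IsMoveOfDir r s i (ε a : Square) (ε b : Square)) ↔
      (b = finRotate _ a ∧ i = startPerm o (cycleWord e)[a]) ∨
        (a = finRotate _ b ∧ i = startPerm o (cycleWord e)[b] + 4) := by
  obtain ⟨hp, hpq⟩ := startParams_pos hr hrs o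
  rw [secondCycle_eq_perfectCycle]
  let visitEquiv : Fin (cycleWord e).length ≃
      OctoPath.board (perfectCycle (startParams o r s).1 (startParams o r s).2 e) :=
    .ofBijective (fun a => ⟨visit _ _ e a, exists_visit_eq_iff.1 ⟨a, rfl⟩⟩)
      ⟨fun a b h => visit_injective hp hpq e (congrArg Subtype.val h), fun x => by
        obtain ⟨a, ha⟩ := exists_visit_eq_iff.2 x.2
        exact ⟨a, Subtype.ext ha⟩⟩
  refine ⟨visitEquiv, fun a i b => ?_⟩
  have adj_iff : (OctoPath.cycleGraph _).Adj (visitEquiv a) (visitEquiv b) ↔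
      visitEquiv a ≠ visitEquiv b ∧ (b = finRotate _ a ∨ a = finRotate _ b) := by
    rw [OctoPath.cycleGraph, SimpleGraph.fromRel_adj]
    exact and_congr_right' (or_congr (exists_successive_iff hp hpq) (exists_successive_iff hp hpq))
  rw [adj_iff, isMoveOfDir_iff]
  have ne_of_move (h : (visitEquiv b : Square) = visitEquiv a + moveVec r s i) :
      visitEquiv a ≠ visitEquiv b := fun hab =>
    moveVec_ne_zero hr i (left_eq_add.1 ((congrArg Subtype.val hab).trans h))
  constructor
  · rintro ⟨⟨-, rfl | rfl⟩, hi⟩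
    · exact Or.inl ⟨rfl, (visit_finRotate_eq_iff hr hrs o _ i).1 hi⟩
    · exact Or.inr ⟨rfl, (eq_visit_finRotate_add_iff hr hrs o _ i).1 hi⟩
  · rintro (⟨rfl, hi⟩ | ⟨rfl, hi⟩)
    · have hi := (visit_finRotate_eq_iff hr hrs o _ i).2 hi
      exact ⟨⟨ne_of_move hi, Or.inl rfl⟩, hi⟩
    · have hi := (eq_visit_finRotate_add_iff hr hrs o _ i).2 hi
      exact ⟨⟨ne_of_move hi, Or.inr rfl⟩, hi⟩

theorem extractedFromSecond_iff {r s : ℕ} (hr : 0 < r) (hrs : r < s) {o : OriginType}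
    {e : List LiftType} {Φ : DirectionGraph} : ExtractedFromSecond r s o e Φ ↔
      IsDirectionCycle (finRotate _) (fun k => startPerm o (cycleWord e)[k]) Φ := by
  obtain ⟨ε, hε⟩ := exists_equiv_cycleGraph (r := r) (s := s) (by omega) (by omega) o e
  constructor
  · rintro ⟨σ, hσ⟩
    exact ⟨ε.trans σ, fun a i b => by rw [← hε, hσ]; rfl⟩
  · rintro ⟨v, hv⟩
    refine ⟨ε.symm.trans v, fun x y i => ?_⟩
    obtain ⟨a, rfl⟩ := ε.surjective x
    obtain ⟨b, rfl⟩ := ε.surjective y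
    simp only [hε, Equiv.trans_apply, Equiv.symm_apply_apply, hv]

theorem exists_extractedFromSecond {r s : ℕ} (hr : 0 < r) (hrs : r < s) (o : OriginType)
    (e : List LiftType) : ∃ Φ, ExtractedFromSecond r s o e Φ := by
  simp only [extractedFromSecond_iff hr hrs]
  exact exists_isDirectionCycle linearIndependent_formal _ _ _
    (visit_finRotate o ((1, 0) : ℤ × ℤ) (0, 1))

namespace IsSecondFundamental

variable {o o' : OriginType} {e : List LiftType} {Φ Ψ : DirectionGraph}

theorem isDirectionCycle (h : IsSecondFundamental o e Φ) :
    IsDirectionCycle (finRotate _) (fun k => startPerm o (cycleWord e)[k]) Φ := by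
  obtain ⟨r, s, hr, hrs, h⟩ := h
  exact (extractedFromSecond_iff hr hrs).1 h

theorem pairCounts_eq (h : IsSecondFundamental o e Φ) :
    Φ.pairCounts = countMultiset (transpose e) := by
  obtain ⟨τ, hτ⟩ := (isEquivalencePerm_startPerm o).exists_perm
  have turn_startPerm (c i j) : turn (τ c) (startPerm o i) (startPerm o j) = turn c i j := by
    simp only [turn, ← hτ, ← startPerm_add_four, EmbeddingLike.apply_eq_iff_eq]
  have pairCount_eq (c) : Φ.pairCount (τ c) =
      4 * ((counts (transpose e) (1, 1)).1 * turn c 0 1 +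
        (counts (transpose e) (1, 1)).2 * turn c 1 2) := by
    obtain ⟨i, hi, hturns⟩ := turns_cycleWord c e
    rw [counts_transpose e (1, 1) (turn c 0 1, turn c 1 2), one_mul, one_mul, ← hturns,
      turns_concat_head_eq_sum c hi, h.isDirectionCycle.pairCount_eq_sum]
    simp only [turn_startPerm]
  have huniv : (Finset.univ : Finset (Fin 4)).val = {1, 0, 3, 2} := by decide
  have hvalues : turn 1 0 1 = 0 ∧ turn 1 1 2 = 1 ∧ turn 0 0 1 = 0 ∧ turn 0 1 2 = 0 ∧
      turn 3 0 1 = 0 ∧ turn 3 1 2 = 0 ∧ turn 2 0 1 = 1 ∧ turn 2 1 2 = 0 := by decide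
  rw [DirectionGraph.pairCounts, ← Multiset.map_univ_val_equiv τ, Multiset.map_map, huniv]
  simp [pairCount_eq, hvalues, countMultiset]

theorem equivalent (h : IsSecondFundamental o e Φ) (h' : IsSecondFundamental o' e Ψ) :
    Φ.Equivalent Ψ :=
  h.isDirectionCycle.equivalent h'.isDirectionCycle
    ((isEquivalencePerm_startPerm o).symm.trans (isEquivalencePerm_startPerm o'))
    (fun i => by simp [startPerm_symm_add_four, startPerm_add_four]) (Equiv.refl _)
    (fun _ => rfl) (fun _ => by simp)

theorem equivalent_companion (h : IsSecondFundamental o e Φ)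
    (h' : IsSecondFundamental o' (companion e) Ψ) : Φ.Equivalent Ψ := by
  obtain ⟨m, hm⟩ := cycleWord_companion e
  have hlength : (cycleWord e).length = (cycleWord (companion e)).length := by
    simpa using (congrArg List.length hm).symm
  have : NeZero (cycleWord e).length := ⟨by simp [cycleWord, List.finRange_succ]⟩
  let ε : Fin (cycleWord e).length ≃ Fin (cycleWord (companion e)).length :=
    (Equiv.addRight (Fin.ofNat _ m)).trans (finCongr hlength)
  have hε (a) : (ε a).val = (a.val + m) % (cycleWord (companion e)).length :=
    (Nat.add_mod_mod _ _ _).trans (congrArg _ hlength)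
  have letter_eq (a) : (cycleWord (companion e))[ε a] = (cycleWord e)[a] + 1 := by
    have := List.getElem_of_eq hm (i := a.val) (by simp [← hlength])
    rw [List.getElem_rotate, List.getElem_map] at this
    simpa only [Fin.getElem_fin, hε] using this
  refine h.isDirectionCycle.equivalent h'.isDirectionCycle
    (((isEquivalencePerm_startPerm o).symm.trans isEquivalencePerm_addRight_one).trans
      (isEquivalencePerm_startPerm o')) (fun i => ?_) ε (fun a => Fin.ext ?_) (fun a => ?_)
  · simp [startPerm_symm_add_four, startPerm_add_four, add_right_comm]
  · simp only [hε, coe_finRotate_eq_mod, hlength]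
    rw [Nat.mod_add_mod, Nat.mod_add_mod, add_right_comm]
  · simp [letter_eq]

end IsSecondFundamental

/-! ## Comparing direction cycles -/

theorem IsFundamental.pairCounts_eq {e : List LiftType} {Φ : DirectionGraph}
    (h : IsFundamental e Φ) : Φ.pairCounts = countMultiset e :=
  (isFundamental_iff.1 h).pairCounts_eq

theorem IsFundamental.coincide_iff {e e' : List LiftType} {Φ Ψ : DirectionGraph}
    (hΦ : IsFundamental e Φ) (hΨ : IsFundamental e' Ψ) : Φ.Coincide Ψ ↔ e = e' := by
  rw [isFundamental_iff] at hΦ hΨ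
  refine ⟨hΦ.eq_of_coincide hΨ, ?_⟩
  rintro rfl
  exact IsMoveGraph.coincide hΦ hΨ

theorem IsFundamental.equivalent {e : List LiftType} {Φ Ψ : DirectionGraph}
    (hΦ : IsFundamental e Φ) (hΨ : IsFundamental e Ψ) : Φ.Equivalent Ψ :=
  ((hΦ.coincide_iff hΨ).2 rfl).equivalent

theorem IsFundamental.equivalent_companion {e : List LiftType} {Φ Ψ : DirectionGraph}
    (hΦ : IsFundamental e Φ) (hΨ : IsFundamental (companion e) Ψ) : Φ.Equivalent Ψ :=
  (isFundamental_iff.1 hΦ).equivalent_companion (isFundamental_iff.1 hΨ)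

theorem IsFundamental.equivalent_iff {e e' : List LiftType} {Φ Ψ : DirectionGraph}
    (hΦ : IsFundamental e Φ) (hΨ : IsFundamental e' Ψ) :
    Φ.Equivalent Ψ ↔ e = e' ∨ e' = companion e := by
  constructor
  · intro h
    apply eq_or_companion_of_countMultiset
    rw [← hΦ.pairCounts_eq, ← hΨ.pairCounts_eq, h.pairCounts_eq]
  · rintro (rfl | rfl)
    · exact hΦ.equivalent hΨ
    · exact hΦ.equivalent_companion hΨ

theorem exists_isFundamental (e : List LiftType) : ∃ Φ, IsFundamental e Φ := by
  simpa only [isFundamental_iff] using exists_isFormalMoveGraph e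

theorem exists_isSecondFundamental (o : OriginType) (e : List LiftType) :
    ∃ Φ, IsSecondFundamental o e Φ :=
  (exists_extractedFromSecond one_pos one_lt_two o e).imp fun _ h =>
    ⟨1, 2, one_pos, one_lt_two, h⟩

theorem IsFundamentalOrSecond.exists_pairCounts_eq {e : List LiftType} {Φ : DirectionGraph}
    (h : IsFundamentalOrSecond e Φ) : ∃ e', (.h ∈ e' ↔ .h ∈ e) ∧ (.hbar ∈ e' ↔ .hbar ∈ e) ∧
      Φ.pairCounts = countMultiset e' := by
  rcases h with h | ⟨o, h⟩
  · exact ⟨e, Iff.rfl, Iff.rfl, h.pairCounts_eq⟩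
  · exact ⟨transpose e, h_mem_transpose, hbar_mem_transpose, h.pairCounts_eq⟩

theorem IsClassical.exists_pairCounts_eq {Ψ : DirectionGraph} (h : IsClassical Ψ) :
    ∃ e, .hbar ∉ e ∧ Ψ.pairCounts = countMultiset e := by
  obtain ⟨e, hbar_notMem, h⟩ := h
  have h : IsFundamentalOrSecond e Ψ := h.imp_right fun h => h.elim (⟨_, ·⟩) (⟨_, ·⟩)
  obtain ⟨e', -, hbar_iff, hcount⟩ := h.exists_pairCounts_eq
  exact ⟨e', mt hbar_iff.1 hbar_notMem, hcount⟩

theorem IsFundamentalOrSecond.exists_isClassical_of_hbar_notMem {e : List LiftType}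
    {Φ : DirectionGraph} (h : IsFundamentalOrSecond e Φ) (hbar_notMem : .hbar ∉ e) :
    ∃ Ψ, IsClassical Ψ ∧ Φ.Equivalent Ψ := by
  rcases h with h | ⟨o, h⟩
  · exact ⟨Φ, ⟨e, hbar_notMem, .inl h⟩, h.equivalent h⟩
  · obtain ⟨Ψ, hΨ⟩ := exists_isSecondFundamental .g e
    exact ⟨Ψ, ⟨e, hbar_notMem, .inr (.inl hΨ)⟩, h.equivalent hΨ⟩

theorem IsFundamentalOrSecond.exists_isClassical_of_h_notMem {e : List LiftType}
    {Φ : DirectionGraph} (h : IsFundamentalOrSecond e Φ) (h_notMem : .h ∉ e) :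
    ∃ Ψ, IsClassical Ψ ∧ Φ.Equivalent Ψ := by
  have hbar_notMem : .hbar ∉ companion e := mt hbar_mem_companion.1 h_notMem
  rcases h with h | ⟨o, h⟩
  · obtain ⟨Ψ, hΨ⟩ := exists_isFundamental (companion e)
    exact ⟨Ψ, ⟨_, hbar_notMem, .inl hΨ⟩, h.equivalent_companion hΨ⟩
  · obtain ⟨Ψ, hΨ⟩ := exists_isSecondFundamental .g (companion e)
    exact ⟨Ψ, ⟨_, hbar_notMem, .inr (.inl hΨ)⟩, h.equivalent_companion hΨ⟩

theorem IsFundamentalOrSecond.not_equivalent_of_isClassical {e : List LiftType}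
    {Φ Ψ : DirectionGraph} (hΦ : IsFundamentalOrSecond e Φ) (h_mem : .h ∈ e)
    (hbar_mem : .hbar ∈ e) (hΨ : IsClassical Ψ) : ¬ Φ.Equivalent Ψ := by
  intro h
  obtain ⟨e₁, h_iff, hbar_iff, hcount₁⟩ := hΦ.exists_pairCounts_eq
  obtain ⟨e₂, hbar_notMem, hcount₂⟩ := hΨ.exists_pairCounts_eq
  rcases eq_or_companion_of_countMultiset (hcount₁.symm.trans (h.pairCounts_eq.trans hcount₂))
    with rfl | rfl
  · exact hbar_notMem (hbar_iff.2 hbar_mem)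
  · exact hbar_notMem (hbar_mem_companion.2 (h_iff.2 h_mem))

theorem IsFundamentalOrSecond.forall_not_equivalent_iff {e : List LiftType} {Φ : DirectionGraph}
    (hΦ : IsFundamentalOrSecond e Φ) :
    (∀ Ψ, IsClassical Ψ → ¬ Φ.Equivalent Ψ) ↔ .h ∈ e ∧ .hbar ∈ e := by
  refine ⟨fun hnew => ⟨?_, ?_⟩, fun h Ψ => hΦ.not_equivalent_of_isClassical h.1 h.2⟩ <;>
    by_contra notMem
  · obtain ⟨Ψ, hΨ, h⟩ := hΦ.exists_isClassical_of_h_notMem notMem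
    exact hnew Ψ hΨ h
  · obtain ⟨Ψ, hΨ, h⟩ := hΦ.exists_isClassical_of_hbar_notMem notMem
    exact hnew Ψ hΨ h

end PerfectCycles

end LeaperGraphs

theorem mainTheorem10 :
    -- the direction graphs in question exist: they can be extracted from the cycles
    (∀ r s : ℕ, 0 < r → r < s → ∀ (o : LeaperGraphs.OriginType) (e : List LeaperGraphs.LiftType),
      (∃ Φ, LeaperGraphs.ExtractedFromFirst r s o e Φ) ∧
      (∃ Φ, LeaperGraphs.ExtractedFromSecond r s o e Φ)) ∧
    -- coincidence of fundamental direction cycles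
    (∀ (e₁ e₂ : List LeaperGraphs.LiftType) (Φ₁ Φ₂ : LeaperGraphs.DirectionGraph),
      LeaperGraphs.IsFundamental e₁ Φ₁ → LeaperGraphs.IsFundamental e₂ Φ₂ →
        (Φ₁.Coincide Φ₂ ↔ e₁ = e₂)) ∧
    -- equivalence of fundamental direction cycles
    (∀ (e₁ e₂ : List LeaperGraphs.LiftType) (Φ₁ Φ₂ : LeaperGraphs.DirectionGraph),
      LeaperGraphs.IsFundamental e₁ Φ₁ → LeaperGraphs.IsFundamental e₂ Φ₂ →
        (Φ₁.Equivalent Φ₂ ↔ e₁ = e₂ ∨ e₂ = LeaperGraphs.companion e₁)) ∧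
    -- which graphs of the large family are new
    (∀ (e : List LeaperGraphs.LiftType) (Φ : LeaperGraphs.DirectionGraph),
      LeaperGraphs.IsFundamentalOrSecond e Φ →
        ((∀ Ψ, LeaperGraphs.IsClassical Ψ → ¬ Φ.Equivalent Ψ) ↔
          LeaperGraphs.LiftType.h ∈ e ∧ LeaperGraphs.LiftType.hbar ∈ e)) := by
  refine ⟨fun r s hr hrs o e => ⟨LeaperGraphs.exists_extractedFromFirst hr hrs o e,
    LeaperGraphs.exists_extractedFromSecond hr hrs o e⟩, ?_, ?_, ?_⟩
  · exact fun _ _ _ _ h₁ h₂ => h₁.coincide_iff h₂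
  · exact fun _ _ _ _ h₁ h₂ => h₁.equivalent_iff h₂
  · exact fun _ _ h => h.forall_not_equivalent_iff
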